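/- Let $R=\mathbb{Z}_4+u\mathbb{Z}_4$ with $u^2=0$, let $n=2^k$ with $k\ge 1$, and let $R_n=R[x]/\langle x^n+1\rangle$. A negacyclic code of length $n$ over $R$ is an ideal of $R_n$. Conventions. $h,h_1,h_2$ denote polynomials of degree less than $n$ over $\mathbb{F}_2$, written in powers of $x+1$ and read in $R_n$ by taking their coefficients to be the elements $0,1$ of $R$. "Unit" means unit of $\mathbb{F}_2[x]/\langle x^n+1\rangle$. All of $s,t,l,m,m_1$ are non-negative integers. For a code with first listed generator $g$, $T$ is the smallest integer $T\ge 0$ with $u(x+1)^T\in\langle g\rangle$, and $T_1$ is the smallest integer $T_1\ge 0$ with $2u(x+1)^{T_1}\in\langle g\rangle$. If $h=0$, then all bounds on $\deg h$ count as satisfied and, in Types 3.0 and 3.1, the conditions $t<m$ and $1+t\le m$ are dropped (so $m=0$ is allowed). (i) Every negacyclic code of length $n$ over $R$ is one of the following. - Type 0: $\langle 0\rangle$ or $\langle 1\rangle$. - Type 1: $\langle u(x+1)^m\rangle$, $0\le m\le 2n-1$. - Type 2.0: $\langle (x+1)^s+u(x+1)^th(x)\rangle$, where $1\le s\le n-1$,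 $0\le t<s$, $h$ is zero or a unit, $\deg h\le s-t-1$. - Type 2.1: $\langle (x+1)^s+u(x+1)^th(x)\rangle$, where $n\le s\le 2n-1$, $0\le t<n$, $h$ is zero or a unit, and $\deg h\le 2n-s-1$ if $t<s-n$, $\deg h\le n-t-1$ if $t\ge s-n$. - Type 2.2: $\langle (x+1)^s+2u(x+1)^th(x)\rangle$, where $n<s\le 2n-1$, $0\le t<s-n$, $h$ is a unit, and $\deg h\le 2n-s-1$ if $t<2s-3n$, $\deg h\le s-n-t-1$ if $t\ge 2s-3n$. - Type 2.3: $\langle (x+1)^s+u(x+1)^t(2h_1(x)+(x+1)^lh_2(x))\rangle$, where $n<s\le 2n-1$, $0\le t<s-n$, $l>s-n-t$, $h_1,h_2$ are units, $\deg h_1\le T_1-t-1$, $\deg h_2\le n-t-l-1$. - Type 3.0: $\langle (x+1)^s+u(x+1)^th(x),\ u(x+1)^m\rangle$, where $1\le s\le n-1$, $0\le t<m<s$, $h$ is zero or a unit, $\deg h\le m-t-1$. - Type 3.1: $\langle (x+1)^s+u(x+1)^th(x),\ u(x+1)^m\rangle$, where $n\le s\le 2n-1$, $0\le t<n$, $1+t\le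 m<T$, $h$ is zero or a unit, $\deg h\le m-t-1$. - Type 3.2: $\langle (x+1)^s+2u(x+1)^th(x),\ u(x+1)^m\rangle$, where $n<s\le 2n-1$, $0\le t<s-n$, $1+t\le m<n$, $h$ is a unit, $\deg h\le\min\{m,T_1\}-t-1$. - Type 3.3: $\langle (x+1)^s+2u(x+1)^th(x),\ 2u(x+1)^{m_1}\rangle$, where $n\le s\le 2n-1$, $0\le t<s-n$, $1+t\le m_1<T_1$, $h$ is a unit, $\deg h\le m_1-t-1$. - Type 3.4: $\langle (x+1)^s+u(x+1)^t(2h_1(x)+(x+1)^lh_2(x)),\ u(x+1)^m\rangle$, where $n<s\le 2n-1$, $0\le t<s-n$, $t+l<m<n$, $h_1,h_2$ are units. - Type 3.5: $\langle (x+1)^s+u(x+1)^t(2h_1(x)+(x+1)^lh_2(x)),\ 2u(x+1)^{m_1}\rangle$, where $n<s\le 2n-1$, $0\le t<s-n$, $1+t<m_1<T_1$, $h_1,h_2$ are units. (ii) Moreover, every negacyclic code of length $n$ over $R$ belongs to exactly one of the Types 0, 1, 2.0, 2.1, 2.2, 2.3, 3.0, 3.1, 3.3, and its parameters within that type are unique,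 where one takes $t=0$ whenever $h=0$. (Thus these types list each code once; the codes of Types 3.2, 3.4 and 3.5 are repetitions.) -/

import Mathlib

open Polynomial

noncomputable section

namespace Negacyclic

/-- The ring `ℤ₄ + uℤ₄` with `u² = 0`: the dual numbers over `ℤ/4ℤ`. -/
abbrev R : Type := DualNumber (ZMod 4)

/-- The ring `R[x]/⟨xⁿ + 1⟩`. Negacyclic codes of length `n` over `R` are its ideals. -/
abbrev Rn (n : ℕ) : Type := AdjoinRoot ((X : R[X]) ^ n + 1)

/-- The ring `𝔽₂[x]/⟨xⁿ + 1⟩`. -/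
abbrev Fn (n : ℕ) : Type := AdjoinRoot ((X : (ZMod 2)[X]) ^ n + 1)

/-- The element `u` of `R[x]/⟨xⁿ + 1⟩`. -/
def u (n : ℕ) : Rn n := AdjoinRoot.of _ (DualNumber.eps : R)

/-- The element `x + 1` of `R[x]/⟨xⁿ + 1⟩`. -/
def y (n : ℕ) : Rn n := AdjoinRoot.root _ + 1

/-- The element of `R[x]/⟨xⁿ + 1⟩` denoted by a binary polynomial `h(x) = ∑ hⱼ (x + 1)ʲ`: each
coefficient `hⱼ ∈ {0, 1}` is read in `R`. The `hⱼ` are the coefficients of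
`taylor 1 h = h(X + 1)`, since `h(x) = h((x + 1) + 1)` over `𝔽₂`. -/
def lift (n : ℕ) (h : (ZMod 2)[X]) : Rn n :=
  (taylor 1 h).sum fun j a => ((ZMod.val a : ℕ) : Rn n) * y n ^ j

/-- `h` is the representative, of degree less than `n`, of a unit of `𝔽₂[x]/⟨xⁿ + 1⟩`. -/
def IsUnitRep (n : ℕ) (h : (ZMod 2)[X]) : Prop :=
  h.degree < n ∧ IsUnit (AdjoinRoot.mk ((X : (ZMod 2)[X]) ^ n + 1) h : Fn n)

/-- `(x + 1)ˢ + u (x + 1)ᵗ h(x)` -/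
def gen (n s t : ℕ) (h : (ZMod 2)[X]) : Rn n :=
  y n ^ s + u n * y n ^ t * lift n h

/-- `(x + 1)ˢ + 2u (x + 1)ᵗ h(x)` -/
def genTwo (n s t : ℕ) (h : (ZMod 2)[X]) : Rn n :=
  y n ^ s + 2 * u n * y n ^ t * lift n h

/-- `(x + 1)ˢ + u (x + 1)ᵗ (2 h₁(x) + (x + 1)ˡ h₂(x))` -/
def genMix (n s t l : ℕ) (h₁ h₂ : (ZMod 2)[X]) : Rn n :=
  y n ^ s + u n * y n ^ t * (2 * lift n h₁ + y n ^ l * lift n h₂)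

/-- The smallest `T` such that `u (x + 1)ᵀ ∈ ⟨g⟩` (it exists, as `x + 1` is nilpotent when `n` is
a positive power of two). -/
def minT {n : ℕ} (g : Rn n) : ℕ := sInf {T : ℕ | u n * y n ^ T ∈ Ideal.span {g}}

/-- The smallest `T₁` such that `2u (x + 1)^T₁ ∈ ⟨g⟩`. -/
def minT₁ {n : ℕ} (g : Rn n) : ℕ := sInf {T : ℕ | 2 * u n * y n ^ T ∈ Ideal.span {g}}

/-- A type of negacyclic code, together with the parameters of a code of that type. -/
inductive Param : Type
  | zero
  | one
  | type1 (m : ℕ)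
  | type20 (s t : ℕ) (h : (ZMod 2)[X])
  | type21 (s t : ℕ) (h : (ZMod 2)[X])
  | type22 (s t : ℕ) (h : (ZMod 2)[X])
  | type23 (s t l : ℕ) (h₁ h₂ : (ZMod 2)[X])
  | type30 (s t m : ℕ) (h : (ZMod 2)[X])
  | type31 (s t m : ℕ) (h : (ZMod 2)[X])
  | type32 (s t m : ℕ) (h : (ZMod 2)[X])
  | type33 (s t m₁ : ℕ) (h : (ZMod 2)[X])
  | type34 (s t l m : ℕ) (h₁ h₂ : (ZMod 2)[X])
  | type35 (s t l m₁ : ℕ) (h₁ h₂ : (ZMod 2)[X])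

namespace Param

/-- The code with the given type and parameters. -/
def code (n : ℕ) : Param → Ideal (Rn n)
  | zero => Ideal.span {0}
  | one => Ideal.span {1}
  | type1 m => Ideal.span {u n * y n ^ m}
  | type20 s t h => Ideal.span {gen n s t h}
  | type21 s t h => Ideal.span {gen n s t h}
  | type22 s t h => Ideal.span {genTwo n s t h}
  | type23 s t l h₁ h₂ => Ideal.span {genMix n s t l h₁ h₂}
  | type30 s t m h => Ideal.span {gen n s t h, u n * y n ^ m}
  | type31 s t m h => Ideal.span {gen n s t h, u n * y n ^ m}
  | type32 s t m h => Ideal.span {genTwo n s t h, u n * y n ^ m}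
  | type33 s t m₁ h => Ideal.span {genTwo n s t h, 2 * u n * y n ^ m₁}
  | type34 s t l m h₁ h₂ => Ideal.span {genMix n s t l h₁ h₂, u n * y n ^ m}
  | type35 s t l m₁ h₁ h₂ => Ideal.span {genMix n s t l h₁ h₂, 2 * u n * y n ^ m₁}

/-- The parameter ranges and degree bounds of the types. Inequalities are rearranged so that no
truncated subtraction occurs: `d ≤ a - b - 1` is written `d + b + 1 ≤ a`, and so on.
In types 3.0 and 3.1 with `h = 0` the exponent `t` plays no role, and `t < m` is not required. -/
def Admissible (n : ℕ) : Param → Prop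
  | zero => True
  | one => True
  | type1 m => m ≤ 2 * n - 1
  | type20 s t h =>
      1 ≤ s ∧ s ≤ n - 1 ∧ t < s ∧
      (h = 0 ∨ IsUnitRep n h ∧ h.natDegree + t + 1 ≤ s)
  | type21 s t h =>
      n ≤ s ∧ s ≤ 2 * n - 1 ∧ t < n ∧
      (h = 0 ∨ IsUnitRep n h ∧
        (if t + n < s then h.natDegree + s + 1 ≤ 2 * n else h.natDegree + t + 1 ≤ n))
  | type22 s t h =>
      n < s ∧ s ≤ 2 * n - 1 ∧ t + n < s ∧ IsUnitRep n h ∧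
      (if t + 3 * n < 2 * s then h.natDegree + s + 1 ≤ 2 * n
        else h.natDegree + n + t + 1 ≤ s)
  | type23 s t l h₁ h₂ =>
      n < s ∧ s ≤ 2 * n - 1 ∧ t + n < s ∧ s < l + n + t ∧ IsUnitRep n h₁ ∧ IsUnitRep n h₂ ∧
      h₁.natDegree + t + 1 ≤ minT₁ (genMix n s t l h₁ h₂) ∧ h₂.natDegree + t + l + 1 ≤ n
  | type30 s t m h =>
      1 ≤ s ∧ s ≤ n - 1 ∧ m < s ∧
      (h = 0 ∨ IsUnitRep n h ∧ t < m ∧ h.natDegree + t + 1 ≤ m)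
  | type31 s t m h =>
      n ≤ s ∧ s ≤ 2 * n - 1 ∧ t < n ∧ m < minT (gen n s t h) ∧
      (h = 0 ∨ IsUnitRep n h ∧ 1 + t ≤ m ∧ h.natDegree + t + 1 ≤ m)
  | type32 s t m h =>
      n < s ∧ s ≤ 2 * n - 1 ∧ t + n < s ∧ 1 + t ≤ m ∧ m < n ∧ IsUnitRep n h ∧
      h.natDegree + t + 1 ≤ min m (minT₁ (genTwo n s t h))
  | type33 s t m₁ h =>
      n ≤ s ∧ s ≤ 2 * n - 1 ∧ t + n < s ∧ 1 + t ≤ m₁ ∧ m₁ < minT₁ (genTwo n s t h) ∧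
      IsUnitRep n h ∧ h.natDegree + t + 1 ≤ m₁
  | type34 s t l m h₁ h₂ =>
      n < s ∧ s ≤ 2 * n - 1 ∧ t + n < s ∧ t + l < m ∧ m < n ∧
      IsUnitRep n h₁ ∧ IsUnitRep n h₂
  | type35 s t l m₁ h₁ h₂ =>
      n < s ∧ s ≤ 2 * n - 1 ∧ t + n < s ∧ 1 + t < m₁ ∧ m₁ < minT₁ (genMix n s t l h₁ h₂) ∧
      IsUnitRep n h₁ ∧ IsUnitRep n h₂

/-- The types that list every code once: all except 3.2, 3.4 and 3.5, whose codes also occur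
under other types. When `h = 0` the code does not depend on `t`, and `t = 0` is chosen. -/
def Normalized : Param → Prop
  | type20 _ t h => h = 0 → t = 0
  | type21 _ t h => h = 0 → t = 0
  | type30 _ t _ h => h = 0 → t = 0
  | type31 _ t _ h => h = 0 → t = 0
  | type32 .. => False
  | type34 .. => False
  | type35 .. => False
  | _ => True

end Param

end Negacyclic

end

/-! Let `A = ℤ₄[x]/⟨xⁿ + 1⟩` and `y = x + 1`. As `n` is a power of two, `yⁿ` is 2 times a unit, so
`A` is a chain ring with residue field `𝔽₂` and nilpotency index `2n` (`isBinaryUniformizer_yA`),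
and `Rₙ = A ⊕ uA` (`isDualExtension`).

An ideal `C` of `A ⊕ uA` has the form `⟨yˢ + ub, uyᵐ⟩`, where `yˢ` generates the image of `C` modulo
`u` and `yᵐ` generates `{c | uc ∈ C}`. The triple `(s, m, b mod yᵐ)` determines `C` and is
determined by it (`exists_hasInvariants`, `HasInvariants.unique`, `HasInvariants.ideal_eq`). If `b`
has valuation `v`, then `yˢ + ub` alone gives `m = min(s, 2n - s + v)`
(`hasInvariants_span_singleton`); for `s < 2n` a second generator is needed exactly when `m` is
smaller.

Modulo `yᵐ`, `b` has a unique expansion in powers of `y` with digits 0 and 1, and a factor 2 shifts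
digits up by `n` positions, up to a unit. The nine types are normal forms for the triples:
`canonical_iff` rewrites their conditions in terms of `s`, `m`, `v`, `exists_canonical` realizes
every triple, and `Canonical.eq_of_invariants_eq` shows that no triple is realized twice. Part (i)
follows from part (ii). -/

namespace Negacyclic

/-! ### Chain rings with residue field `𝔽₂`. -/

/-- `y` generates the maximal ideal of a chain ring with residue field `𝔽₂` and nilpotency
index `N`. -/
structure IsBinaryUniformizer {A : Type*} [CommRing A] (y : A) (N : ℕ) : Prop where
  res : ∀ a, y ∣ a ∨ y ∣ a - 1
  pow_eq_zero : y ^ N = 0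
  pow_ne_zero : ∀ i < N, y ^ i ≠ 0

namespace IsBinaryUniformizer

variable {A : Type*} [CommRing A] {y : A} {N : ℕ}

theorem isNilpotent (hy : IsBinaryUniformizer y N) : IsNilpotent y := ⟨N, hy.pow_eq_zero⟩

theorem isUnit_add (hy : IsBinaryUniformizer y N) {c : A} (hc : IsUnit c) (a : A) :
    IsUnit (c + y * a) := by
  have h : IsNilpotent (y * a) := (Commute.all y a).isNilpotent_mul_right hy.isNilpotent
  exact h.isUnit_add_left_of_commute hc (Commute.all _ _)

theorem isUnit_or_dvd (hy : IsBinaryUniformizer y N) (a : A) : y ∣ a ∨ IsUnit a := by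
  rcases hy.res a with h | ⟨b, hb⟩
  · exact .inl h
  · right
    have := hy.isUnit_add isUnit_one b
    rwa [← hb, add_sub_cancel] at this

theorem exists_unit (hy : IsBinaryUniformizer y N) (a : A) :
    ∃ i ≤ N, ∃ c, IsUnit c ∧ a = y ^ i * c := by
  have key : ∀ j ≤ N, y ^ j ∣ a ∨ ∃ i ≤ N, ∃ c, IsUnit c ∧ a = y ^ i * c := by
    intro j
    induction j with
    | zero => simp
    | succ j ih =>
      intro hj
      rcases ih (by omega) with ⟨b, hb⟩ | h
      · rcases hy.isUnit_or_dvd b with ⟨d, hd⟩ | hu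
        · exact .inl ⟨d, by rw [hb, hd]; ring⟩
        · exact .inr ⟨j, by omega, b, hu, hb⟩
      · exact .inr h
  rcases key N le_rfl with ⟨b, hb⟩ | h
  · exact ⟨N, le_rfl, 1, isUnit_one, by rw [hb, hy.pow_eq_zero]; ring⟩
  · exact h

/-- If `yⁱ = yʲa` with `i < j`, then `yⁱ(1 - y⋯) = 0`; the second factor is a unit, so `yⁱ = 0`
although `i < N`. -/
theorem pow_dvd_iff (hy : IsBinaryUniformizer y N) {i j : ℕ} (hj : j ≤ N) {c : A}
    (hc : IsUnit c) : y ^ j ∣ y ^ i * c ↔ j ≤ i := by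
  rw [hc.dvd_mul_right]
  constructor
  · rintro ⟨a, ha⟩
    by_contra h
    apply hy.pow_ne_zero (N - 1) (by omega)
    have : y ^ i * (1 + y * -(y ^ (j - i - 1) * a)) = 0 := by
      rw [mul_add, mul_one]
      conv_lhs => enter [1]; rw [ha]
      have : y ^ j = y ^ i * y * y ^ (j - i - 1) := by
        rw [← pow_succ, ← pow_add]; congr 1; omega
      rw [this]; ring
    have h0 : y ^ i = 0 := (hy.isUnit_add isUnit_one _).mul_left_eq_zero.mp this
    rw [show N - 1 = i + (N - 1 - i) by omega, pow_add, h0, zero_mul]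
  · exact pow_dvd_pow y

theorem pow_dvd_of_pow_add_dvd (hy : IsBinaryUniformizer y N) {i d : ℕ} (h : i + d ≤ N) {a : A}
    (ha : y ^ (i + d) ∣ y ^ i * a) : y ^ d ∣ a := by
  obtain ⟨e, he, c, hc, rfl⟩ := hy.exists_unit a
  rw [← mul_assoc, ← pow_add, hy.pow_dvd_iff h hc] at ha
  exact (hy.pow_dvd_iff (by omega) hc).2 (by omega)

/-- A class modulo `yᵐ` determines its valuation only up to truncation at `m`. -/
theorem min_val_eq (hy : IsBinaryUniformizer y N) {m v v' : ℕ} (hm : m ≤ N) {c c' : A}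
    (hc : IsUnit c) (hc' : IsUnit c') (h : y ^ m ∣ y ^ v * c - y ^ v' * c') :
    min v m = min v' m := by
  have key : ∀ j ≤ m, (j ≤ v ↔ j ≤ v') := fun j hj => by
    rw [← hy.pow_dvd_iff (hj.trans hm) hc, ← hy.pow_dvd_iff (hj.trans hm) hc']
    exact dvd_iff_dvd_of_dvd_sub ((pow_dvd_pow y hj).trans h)
  have h1 := key (min v m) (by omega)
  have h2 := key (min v' m) (by omega)
  omega

end IsBinaryUniformizer

/-! ### Expansions with digits 0 and 1. -/

/-- The value at `y` of a polynomial over `𝔽₂`, its coefficients being read as `0` and `1`. -/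
noncomputable def binary {A : Type*} [CommRing A] (y : A) (p : (ZMod 2)[X]) : A :=
  p.sum fun j a => ((ZMod.val a : ℕ) : A) * y ^ j

section binary

variable {A : Type*} [CommRing A] {y : A} {N : ℕ}

theorem binary_eq_sum_range {p : (ZMod 2)[X]} {M : ℕ} (h : p.natDegree < M) :
    binary y p = ∑ j ∈ Finset.range M, ((ZMod.val (p.coeff j) : ℕ) : A) * y ^ j :=
  p.sum_over_range' (by simp) M h

@[simp] theorem binary_zero : binary y (0 : (ZMod 2)[X]) = 0 := by simp [binary]

/-- `binary y` is not additive, since digits carry. This Horner recursion replaces additivity in the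
inductions below. -/
theorem binary_eq_divX (p : (ZMod 2)[X]) :
    binary y p = ((ZMod.val (p.coeff 0) : ℕ) : A) + y * binary y p.divX := by
  rw [binary_eq_sum_range (Nat.lt_succ_self _), Finset.sum_range_succ',
    add_comm, binary_eq_sum_range (p := p.divX) (M := p.natDegree + 1)
      (by rw [natDegree_divX_eq_natDegree_tsub_one]; omega), Finset.sum_range_succ,
    coeff_divX, coeff_eq_zero_of_natDegree_lt (Nat.lt_succ_self p.natDegree)]
  simp only [coeff_divX, ZMod.val_zero, Nat.cast_zero, zero_mul, add_zero, pow_zero, mul_one,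
    Finset.mul_sum]
  congr 1
  exact Finset.sum_congr rfl fun i _ => by ring

theorem binary_C_add_X_mul (a : ZMod 2) (q : (ZMod 2)[X]) :
    binary y (C a + X * q) = ((ZMod.val a : ℕ) : A) + y * binary y q := by
  have h : (C a + X * q).divX = q := by ext j; simp [coeff_divX]
  rw [binary_eq_divX, h]
  simp

theorem map_binary {B : Type*} [CommRing B] (f : A →+* B) (p : (ZMod 2)[X]) :
    f (binary y p) = binary (f y) p := by
  simp only [binary, Polynomial.sum, map_sum, map_mul, map_natCast, map_pow]

theorem zmod_two_eq (a : ZMod 2) : a = 0 ∨ a = 1 := by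
  revert a; decide

namespace IsBinaryUniformizer

theorem isUnit_binary (hy : IsBinaryUniformizer y N) {p : (ZMod 2)[X]} (hp : p.coeff 0 = 1) :
    IsUnit (binary y p) := by
  rw [binary_eq_divX, hp]
  simpa [ZMod.val_one] using hy.isUnit_add isUnit_one _

theorem exists_binary (hy : IsBinaryUniformizer y N) (d : ℕ) (a : A) :
    ∃ p : (ZMod 2)[X], p.degree < d ∧ y ^ d ∣ a - binary y p := by
  induction d generalizing a with
  | zero => exact ⟨0, by simp, by simp⟩
  | succ d ih =>
    have : ∃ ε : ZMod 2, y ∣ a - ((ZMod.val ε : ℕ) : A) := by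
      rcases hy.res a with h | h
      · exact ⟨0, by simpa using h⟩
      · exact ⟨1, by simpa [ZMod.val_one] using h⟩
    obtain ⟨ε, b, hb⟩ := this
    obtain ⟨p, hp, e, he⟩ := ih b
    refine ⟨C ε + X * p, ?_, e, ?_⟩
    · rw [degree_lt_iff_coeff_zero] at hp ⊢
      intro j hj
      obtain ⟨j, rfl⟩ : ∃ i, j = i + 1 := ⟨j - 1, by omega⟩
      simpa [coeff_C] using hp j (by omega)
    · rw [binary_C_add_X_mul, ← sub_sub, hb, ← mul_sub, he]; ring

theorem exists_binary_of_isUnit (hy : IsBinaryUniformizer y N) {d : ℕ} (hd : 1 ≤ d) (hN : 1 ≤ N)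
    {a : A} (ha : IsUnit a) :
    ∃ p : (ZMod 2)[X], p.natDegree + 1 ≤ d ∧ p.coeff 0 = 1 ∧ y ^ d ∣ a - binary y p := by
  obtain ⟨p, hp, h⟩ := hy.exists_binary d a
  have h0 : p.coeff 0 = 1 := by
    rcases zmod_two_eq (p.coeff 0) with h0 | h0
    · exfalso
      have h1 : y ^ 1 ∣ a := by
        have := (pow_dvd_pow y hd).trans h
        rw [pow_one] at this ⊢
        rw [dvd_iff_dvd_of_dvd_sub this, binary_eq_divX, h0]
        simp
      have := (hy.pow_dvd_iff (i := 0) hN ha).1 (by simpa using h1)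
      omega
    · exact h0
  refine ⟨p, ?_, h0, h⟩
  have : p ≠ 0 := by rintro rfl; simp at h0
  rw [degree_eq_natDegree this] at hp
  exact_mod_cast hp

/-- Distinct constant digits would make the difference a unit; equal ones cancel, and a factor `y`
can be removed. -/
theorem binary_injective (hy : IsBinaryUniformizer y N) {d : ℕ} (hd : d ≤ N) {p q : (ZMod 2)[X]}
    (hp : p.degree < d) (hq : q.degree < d) (h : y ^ d ∣ binary y p - binary y q) : p = q := by
  induction d generalizing p q with
  | zero =>
    rw [degree_lt_iff_coeff_zero] at hp hq
    ext j
    rw [hp j (by omega), hq j (by omega)]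
  | succ d ih =>
    have h0 : p.coeff 0 = q.coeff 0 := by
      by_contra hne
      have hy1 : y ∣ binary y p - binary y q := (dvd_pow_self y (by omega)).trans h
      have hu : IsUnit (binary y p - binary y q) := by
        rw [binary_eq_divX p, binary_eq_divX q]
        rcases zmod_two_eq (p.coeff 0) with h1 | h1 <;>
          rcases zmod_two_eq (q.coeff 0) with h2 | h2
        · exact absurd (h1.trans h2.symm) hne
        · convert hy.isUnit_add isUnit_one.neg (binary y p.divX - binary y q.divX) using 1
          simp [h1, h2, ZMod.val_one]; ring
        · convert hy.isUnit_add isUnit_one (binary y p.divX - binary y q.divX) using 1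
          simp [h1, h2, ZMod.val_one]; ring
        · exact absurd (h1.trans h2.symm) hne
      have := (hy.pow_dvd_iff (i := 0) (j := 1) (by omega) hu).1 (by simpa using hy1)
      omega
    have h1 : p.divX = q.divX := by
      apply ih (by omega)
      · rw [degree_lt_iff_coeff_zero] at hp ⊢
        intro j hj
        rw [coeff_divX]; exact hp _ (by omega)
      · rw [degree_lt_iff_coeff_zero] at hq ⊢
        intro j hj
        rw [coeff_divX]; exact hq _ (by omega)
      · apply hy.pow_dvd_of_pow_add_dvd (i := 1) (by omega)
        rw [binary_eq_divX p, binary_eq_divX q, h0] at h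
        convert h using 1
        · rw [add_comm]
        · ring
    rw [← divX_mul_X_add p, ← divX_mul_X_add q, h0, h1]

end IsBinaryUniformizer

end binary

/-! ### Ideals of `A ⊕ uA` over a chain ring `A`. -/

/-- `B = A ⊕ uA` with `u² = 0`. -/
structure IsDualExtension {A B : Type*} [CommRing A] [CommRing B] (f : A →+* B) (u : B) :
    Prop where
  mul_self : u * u = 0
  exists_eq : ∀ z, ∃ a c, z = f a + u * f c
  eq_zero : ∀ {a c}, f a + u * f c = 0 → a = 0 ∧ c = 0

section ideals

variable {A B : Type*} [CommRing A] [CommRing B] {f : A →+* B} {u : B} {y : A} {N : ℕ}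

/-- `C = ⟨yˢ + ub, uyᵐ⟩`, where `yˢ` and `yᵐ` generate the residue and the torsion ideal. -/
structure HasInvariants (f : A →+* B) (u : B) (y : A) (N : ℕ) (C : Ideal B) (s m : ℕ) (b : A) :
    Prop where
  eq_span : C = Ideal.span {f (y ^ s) + u * f b, u * f (y ^ m)}
  m_le : m ≤ s
  s_le : s ≤ N
  dvd : y ^ m ∣ y ^ (N - s) * b

theorem IsDualExtension.inj (hu : IsDualExtension f u) {a c a' c' : A}
    (h : f a + u * f c = f a' + u * f c') : a = a' ∧ c = c' := by
  have := hu.eq_zero (a := a - a') (c := c - c') (by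
    rw [map_sub, map_sub]; linear_combination h)
  exact ⟨sub_eq_zero.1 this.1, sub_eq_zero.1 this.2⟩

namespace HasInvariants

theorem mem_iff (hu : IsDualExtension f u) {C : Ideal B} {s m : ℕ}
    {b : A} (h : HasInvariants f u y N C s m b) {a c : A} :
    f a + u * f c ∈ C ↔ ∃ e, a = y ^ s * e ∧ y ^ m ∣ c - e * b := by
  rw [h.eq_span, Ideal.mem_span_pair]
  constructor
  · rintro ⟨z, w, hzw⟩
    obtain ⟨e, e', rfl⟩ := hu.exists_eq z
    obtain ⟨g, g', rfl⟩ := hu.exists_eq w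
    obtain ⟨h1, h2⟩ := hu.inj (a := y ^ s * e) (c := e * b + e' * y ^ s + g * y ^ m)
      (a' := a) (c' := c) (by
      rw [← hzw]
      simp only [map_add, map_mul]
      linear_combination -(f e' * f b + f g' * f (y ^ m)) * hu.mul_self)
    refine ⟨e, h1.symm, ?_⟩
    obtain ⟨d, hd⟩ := pow_dvd_pow y h.m_le
    exact ⟨e' * d + g, by rw [← h2, hd]; ring⟩
  · rintro ⟨e, rfl, d, hd⟩
    refine ⟨f e, f d, ?_⟩
    rw [show c = e * b + y ^ m * d by rw [← hd]; ring]
    simp only [map_add, map_mul]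
    ring

/-- This is where the field `dvd` enters: an element with `yˢe = 0` is a multiple of `y^(N-s)`, and
`y^(N-s)(yˢ + ub) = uy^(N-s)b` must contribute nothing new. -/
theorem u_mul_mem_iff (hy : IsBinaryUniformizer y N) (hu : IsDualExtension f u) {C : Ideal B}
    {s m : ℕ} {b : A} (h : HasInvariants f u y N C s m b) {c : A} :
    u * f c ∈ C ↔ y ^ m ∣ c := by
  have := h.mem_iff hu (a := 0) (c := c)
  rw [map_zero, zero_add] at this
  rw [this]
  constructor
  · rintro ⟨e, he, hc⟩
    have hs := h.s_le
    obtain ⟨d, rfl⟩ := hy.pow_dvd_of_pow_add_dvd (i := s) (d := N - s) (by omega) (a := e)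
      (by rw [← he]; simp)
    have h2 := h.dvd.mul_left d
    rw [dvd_sub_comm] at hc
    rw [show c = d * (y ^ (N - s) * b) - (y ^ (N - s) * d * b - c) by ring]
    exact dvd_sub h2 hc
  · exact fun hc => ⟨0, by simp, by simpa using hc⟩

theorem unique (hy : IsBinaryUniformizer y N) (hu : IsDualExtension f u) {C : Ideal B}
    {s m s' m' : ℕ} {b b' : A} (h : HasInvariants f u y N C s m b)
    (h' : HasInvariants f u y N C s' m' b') : s = s' ∧ m = m' ∧ y ^ m ∣ b - b' := by
  have hm : ∀ {s m s' m' : ℕ} {b b' : A}, HasInvariants f u y N C s m b →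
      HasInvariants f u y N C s' m' b' → m ≤ m' := by
    intro s m s' m' b b' h h'
    have h1 := (h'.u_mul_mem_iff hy hu).2 (dvd_refl (y ^ m'))
    rw [h.u_mul_mem_iff hy hu] at h1
    exact (hy.pow_dvd_iff (h.m_le.trans h.s_le) isUnit_one).1 (by simpa using h1)
  have hs : ∀ {s m s' m' : ℕ} {b b' : A}, HasInvariants f u y N C s m b →
      HasInvariants f u y N C s' m' b' → s ≤ s' := by
    intro s m s' m' b b' h h'
    have h1 := (h'.mem_iff hu (a := y ^ s') (c := b')).2 ⟨1, by simp, by simp⟩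
    obtain ⟨e, he, -⟩ := (h.mem_iff hu).1 h1
    exact (hy.pow_dvd_iff h.s_le isUnit_one).1 (by simp [he])
  obtain rfl := (hm h h').antisymm (hm h' h)
  obtain rfl := (hs h h').antisymm (hs h' h)
  refine ⟨rfl, rfl, ?_⟩
  rw [← h.u_mul_mem_iff hy hu, map_sub]
  have h1 : f (y ^ s) + u * f b ∈ C := (h.mem_iff hu).2 ⟨1, by simp, by simp⟩
  have h2 : f (y ^ s) + u * f b' ∈ C := (h'.mem_iff hu).2 ⟨1, by simp, by simp⟩
  convert C.sub_mem h1 h2 using 1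
  ring

theorem ideal_eq (hu : IsDualExtension f u) {C C' : Ideal B}
    {s m : ℕ} {b b' : A} (h : HasInvariants f u y N C s m b)
    (h' : HasInvariants f u y N C' s m b') (hb : y ^ m ∣ b - b') : C = C' := by
  ext z
  obtain ⟨a, c, rfl⟩ := hu.exists_eq z
  rw [h.mem_iff hu, h'.mem_iff hu]
  refine exists_congr fun e => and_congr_right fun _ => dvd_iff_dvd_of_dvd_sub ?_
  rw [show c - e * b - (c - e * b') = (-e) * (b - b') by ring]
  exact hb.mul_left _

end HasInvariants

/-- Both exponents are chosen least possible. Every element is a power of `y` times a unit, so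
minimality amounts to divisibility. -/
theorem exists_hasInvariants (hy : IsBinaryUniformizer y N) (hu : IsDualExtension f u)
    (C : Ideal B) : ∃ s m b, HasInvariants f u y N C s m b := by
  classical
  have hs : ∃ s, ∃ b, f (y ^ s) + u * f b ∈ C := ⟨N, 0, by simp [hy.pow_eq_zero]⟩
  have hm : ∃ m, u * f (y ^ m) ∈ C := ⟨N, by simp [hy.pow_eq_zero]⟩
  obtain ⟨b, hb⟩ := Nat.find_spec hs
  have hm' := Nat.find_spec hm
  have umin : ∀ c, u * f c ∈ C → y ^ Nat.find hm ∣ c := by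
    intro c hc
    obtain ⟨i, -, d, hd, rfl⟩ := hy.exists_unit c
    refine (pow_dvd_pow y (Nat.find_min' hm ?_)).mul_right d
    rw [map_mul, ← mul_assoc] at hc
    exact (Ideal.mul_unit_mem_iff_mem C (hd.map f)).1 hc
  have smin : ∀ a c, f a + u * f c ∈ C → y ^ Nat.find hs ∣ a := by
    intro a c hc
    obtain ⟨i, -, d, ⟨d, rfl⟩, rfl⟩ := hy.exists_unit a
    refine (pow_dvd_pow y (Nat.find_min' hs ⟨c * ↑d⁻¹, ?_⟩)).mul_right _
    convert C.mul_mem_right (f ↑d⁻¹) hc using 1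
    rw [add_mul, ← map_mul, mul_assoc, mul_assoc, ← map_mul, Units.mul_inv, mul_one]
  refine ⟨Nat.find hs, Nat.find hm, b, le_antisymm ?_ ?_, ?_, ?_, ?_⟩
  · intro z hz
    obtain ⟨a, c, rfl⟩ := hu.exists_eq z
    obtain ⟨e, rfl⟩ := smin _ _ hz
    obtain ⟨d, hd⟩ := umin (c - e * b) (by
      convert C.sub_mem hz (C.mul_mem_left (f e) hb) using 1
      simp only [map_sub, map_mul]; ring)
    rw [Ideal.mem_span_pair]
    refine ⟨f e, f d, ?_⟩
    rw [show c = e * b + y ^ Nat.find hm * d by rw [← hd]; ring]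
    simp only [map_add, map_mul]
    ring
  · rw [Ideal.span_le]
    rintro z (rfl | rfl)
    · exact hb
    · exact hm'
  · apply Nat.find_min'
    convert C.mul_mem_left u hb using 1
    linear_combination -f b * hu.mul_self
  · exact Nat.find_min' hs ⟨0, by simp [hy.pow_eq_zero]⟩
  · apply umin
    have hle : Nat.find hs ≤ N := Nat.find_min' hs ⟨0, by simp [hy.pow_eq_zero]⟩
    convert C.mul_mem_left (f (y ^ (N - Nat.find hs))) hb using 1
    rw [mul_add, ← map_mul, ← pow_add, Nat.sub_add_cancel hle, hy.pow_eq_zero, map_mul]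
    simp; ring

/-- For `g = yˢ + ub`, the multiples `ug = uyˢ` and `y^(N-s)g = uy^(N-s+v)c` account for the two
terms of the minimum. -/
theorem hasInvariants_span_singleton (hy : IsBinaryUniformizer y N) (hu : IsDualExtension f u)
    {s v : ℕ} (hs : s ≤ N) {b c : A} (hc : IsUnit c) (hb : b = y ^ v * c) :
    HasInvariants f u y N (Ideal.span {f (y ^ s) + u * f b}) s (min s (N - s + v)) b where
  eq_span := by
    rw [Ideal.span_pair_comm, Ideal.span_insert, eq_comm, sup_eq_right,
      Ideal.span_singleton_le_span_singleton]
    rcases le_total s (N - s + v) with h | h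
    · rw [min_eq_left h]
      exact ⟨u, by linear_combination -f b * hu.mul_self⟩
    · rw [min_eq_right h]
      obtain ⟨c, rfl⟩ := hc
      refine ⟨f (y ^ (N - s) * ↑c⁻¹), ?_⟩
      have h1 : y ^ s * y ^ (N - s) = 0 := by
        rw [← pow_add, Nat.add_sub_cancel' hs, hy.pow_eq_zero]
      have h2 : b * (y ^ (N - s) * ↑c⁻¹) = y ^ (N - s + v) := by
        rw [hb, pow_add, show y ^ v * (c : A) * (y ^ (N - s) * ↑c⁻¹)
          = y ^ (N - s) * y ^ v * (c * ↑c⁻¹) by ring, Units.mul_inv, mul_one]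
      rw [add_mul, ← map_mul, mul_assoc, ← map_mul, h2, ← mul_assoc, h1]
      simp
  m_le := min_le_left _ _
  s_le := hs
  dvd := by
    rw [hb, ← mul_assoc, ← pow_add]
    exact (pow_dvd_pow y (min_le_right _ _)).mul_right c

end ideals


/-! ### Units of `𝔽₂[x]/⟨xⁿ + 1⟩`. -/

section lift

theorem lift_eq_binary (n : ℕ) (h : (ZMod 2)[X]) : lift n h = binary (y n) (taylor 1 h) := rfl

/-- In characteristic two `(X - 1)^(2ᵏ) = X^(2ᵏ) + 1`, so `X - 1` is nilpotent in the quotient and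
`h` is a unit exactly when `h(1) = 1`. -/
theorem isUnitRep_iff {k : ℕ} {h : (ZMod 2)[X]} :
    IsUnitRep (2 ^ k) h ↔ h.natDegree < 2 ^ k ∧ (taylor 1 h).coeff 0 = 1 := by
  have hu : IsUnit (AdjoinRoot.mk ((X : (ZMod 2)[X]) ^ 2 ^ k + 1) h) ↔
      (taylor 1 h).coeff 0 = 1 := by
    rw [taylor_coeff_zero]
    constructor
    · intro h1
      obtain ⟨g, hg⟩ := h1.exists_right_inv
      obtain ⟨g, rfl⟩ := AdjoinRoot.mk_surjective g
      rw [← map_mul, ← map_one (AdjoinRoot.mk _), AdjoinRoot.mk_eq_mk] at hg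
      obtain ⟨q, hq⟩ := hg
      have := congrArg (eval 1) hq
      rcases zmod_two_eq (eval 1 h) with h0 | h0
      · simp only [eval_sub, eval_mul, eval_add, eval_pow, eval_X, eval_one, one_pow, h0] at this
        rw [show (1 : ZMod 2) + 1 = 0 from rfl] at this
        simp at this
      · exact h0
    · intro h1
      have h2 : X - C 1 ∣ h - 1 := by rw [dvd_iff_isRoot]; simp [h1]
      obtain ⟨q, hq⟩ := h2
      have hn : IsNilpotent (AdjoinRoot.mk ((X : (ZMod 2)[X]) ^ 2 ^ k + 1) ((X - C 1) * q)) := by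
        rw [map_mul]
        refine (Commute.all _ _).isNilpotent_mul_right ⟨2 ^ k, ?_⟩
        rw [← map_pow, sub_pow_char_pow, ← C_pow, one_pow, C_1, CharTwo.sub_eq_add,
          AdjoinRoot.mk_self]
      rw [eq_add_of_sub_eq' hq, map_add, map_one]
      exact hn.isUnit_one_add
  rw [IsUnitRep, hu]
  refine and_congr_left fun h1 => ?_
  have : h ≠ 0 := by rintro rfl; simp at h1
  rw [degree_eq_natDegree this, Nat.cast_lt]

end lift

/-! ### `ℤ₄[x]/⟨xⁿ + 1⟩` is a chain ring. -/

/-- The ring `ℤ₄[x]/⟨xⁿ + 1⟩`. -/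
abbrev An (n : ℕ) : Type := AdjoinRoot ((X : (ZMod 4)[X]) ^ n + 1)

/-- The element `x + 1` of `ℤ₄[x]/⟨xⁿ + 1⟩`. -/
noncomputable def yA (n : ℕ) : An n := AdjoinRoot.root _ + 1

theorem exists_X_add_one_pow {k : ℕ} (hk : 1 ≤ k) : ∃ r : ℤ[X],
    (X + 1) ^ 2 ^ k = X ^ 2 ^ k + 1 + 2 * (-1 + (X + 1) * r) := by
  obtain ⟨q, hq⟩ : ∃ q : ℤ[X], (X + 1) ^ 2 ^ k = X ^ 2 ^ k + 1 + 2 * q := by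
    obtain ⟨q, hq⟩ := exists_add_pow_prime_pow_eq Nat.prime_two (X : ℤ[X]) 1 k
    exact ⟨X * q, by rw [hq]; push_cast; ring⟩
  have h1 : (X : ℤ[X]) + 1 = X - C (-1) := by simp
  -- At `X = -1` the left side vanishes and, `2ᵏ` being even, the right side is `2 + 2q(-1)`.
  have h2 : (X : ℤ[X]) + 1 ∣ q + 1 := by
    rw [h1, dvd_iff_isRoot, IsRoot.def]
    have := congrArg (eval (-1)) hq
    have he : Even (2 ^ k) := (Nat.even_pow.2 ⟨even_two, by omega⟩)
    simp [he.neg_one_pow] at this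
    simp; omega
  obtain ⟨r, hr⟩ := h2
  exact ⟨r, by rw [hq, ← hr]; ring⟩

theorem root_pow (n : ℕ) : (AdjoinRoot.root ((X : (ZMod 4)[X]) ^ n + 1)) ^ n + 1 = 0 := by
  have := AdjoinRoot.eval₂_root ((X : (ZMod 4)[X]) ^ n + 1)
  simpa using this

theorem four_eq_zero (n : ℕ) : (4 : An n) = 0 := by
  have : (algebraMap (ZMod 4) (An n)) ((4 : ℕ) : ZMod 4) = 0 := by
    rw [show ((4 : ℕ) : ZMod 4) = 0 from by decide, map_zero]
  rw [map_natCast] at this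
  exact_mod_cast this

theorem exists_yA_pow_eq {k : ℕ} (hk : 1 ≤ k) :
    ∃ r : An (2 ^ k), yA (2 ^ k) ^ 2 ^ k = 2 * (-1 + yA (2 ^ k) * r) := by
  obtain ⟨r, hr⟩ := exists_X_add_one_pow hk
  have := congrArg (aeval (AdjoinRoot.root ((X : (ZMod 4)[X]) ^ 2 ^ k + 1))) hr
  simp only [map_add, map_mul, map_pow, aeval_X, map_one, map_neg, map_ofNat, root_pow,
    zero_add] at this
  exact ⟨_, this⟩

theorem isNilpotent_yA {k : ℕ} (hk : 1 ≤ k) : yA (2 ^ k) ^ (2 * 2 ^ k) = 0 := by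
  obtain ⟨r, hr⟩ := exists_yA_pow_eq hk
  rw [mul_comm, pow_mul, hr]
  linear_combination (-1 + yA (2 ^ k) * r) ^ 2 * four_eq_zero (2 ^ k)

theorem exists_unit_yA_pow_eq {k : ℕ} (hk : 1 ≤ k) :
    ∃ w : An (2 ^ k), IsUnit w ∧ yA (2 ^ k) ^ 2 ^ k = 2 * w := by
  obtain ⟨r, hr⟩ := exists_yA_pow_eq hk
  refine ⟨_, ?_, hr⟩
  have h : IsNilpotent (yA (2 ^ k) * r) :=
    (Commute.all _ r).isNilpotent_mul_right ⟨_, isNilpotent_yA hk⟩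
  exact h.isUnit_add_left_of_commute isUnit_one.neg (Commute.all _ _)

/-- The representative has degree below that of the monic modulus, and its coefficient of `X^(n-1)`
is `2 ≠ 0` in `ℤ₄`. -/
theorem two_mul_yA_pow_ne_zero {n : ℕ} (hn : 1 ≤ n) : 2 * yA n ^ (n - 1) ≠ 0 := by
  intro h
  have : Nontrivial (ZMod 4) := ZMod.nontrivial_iff.2 (by decide)
  have h1 : AdjoinRoot.mk ((X : (ZMod 4)[X]) ^ n + 1) (C 2 * (X + 1) ^ (n - 1)) = 0 := by
    rw [← h, map_mul, AdjoinRoot.mk_C, map_ofNat, map_pow, map_add, AdjoinRoot.mk_X, map_one, yA]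
  have hm : ((X : (ZMod 4)[X]) + C 1).Monic := monic_X_add_C 1
  have hd : (C 2 * ((X : (ZMod 4)[X]) + 1) ^ (n - 1)).degree <
      ((X : (ZMod 4)[X]) ^ n + 1).degree := by
    rw [← C_1, degree_X_pow_add_C (by omega)]
    rw [← smul_eq_C_mul]
    refine (degree_smul_le _ _).trans_lt ?_
    refine (degree_pow_le _ _).trans_lt ?_
    rw [degree_X_add_C, nsmul_one]
    exact_mod_cast (by omega : n - 1 < n)
  rw [AdjoinRoot.mk_eq_zero] at h1
  have hmon : ((X : (ZMod 4)[X]) ^ n + C 1).Monic := monic_X_pow_add_C 1 (by omega)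
  have h2 := hmon.not_dvd_of_degree_lt (p := (X : (ZMod 4)[X]) ^ n + C 1)
    (q := C 2 * (X + 1) ^ (n - 1)) ?_
    (by simpa using hd)
  · exact h2 (by simpa using h1)
  · intro h0
    have := congrArg (coeff · (n - 1)) h0
    have hc : (((X : (ZMod 4)[X]) + C 1) ^ (n - 1)).coeff (n - 1) = 1 := by
      have := (hm.pow (n - 1)).coeff_natDegree
      rwa [hm.natDegree_pow, natDegree_X_add_C, mul_one] at this
    rw [C_1] at hc
    simp only [coeff_C_mul, hc, coeff_zero] at this
    revert this; decide

theorem isBinaryUniformizer_yA {k : ℕ} (hk : 1 ≤ k) :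
    IsBinaryUniformizer (yA (2 ^ k)) (2 * 2 ^ k) where
  pow_eq_zero := isNilpotent_yA hk
  pow_ne_zero i hi h0 := by
    obtain ⟨w, hw, h⟩ := exists_unit_yA_pow_eq hk
    have h1 : yA (2 ^ k) ^ (2 ^ k + (2 ^ k - 1)) = 0 := by
      rw [show 2 ^ k + (2 ^ k - 1) = i + (2 ^ k + (2 ^ k - 1) - i) by omega, pow_add, h0, zero_mul]
    rw [pow_add, h, mul_right_comm] at h1
    exact two_mul_yA_pow_ne_zero Nat.one_le_two_pow (hw.mul_left_eq_zero.1 h1)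
  res a := by
    have h2 : yA (2 ^ k) ∣ 2 := by
      obtain ⟨w, hw, h⟩ := exists_unit_yA_pow_eq hk
      rw [← hw.dvd_mul_right, ← h]
      exact dvd_pow_self _ (by positivity)
    -- The elements congruent to 0 or 1 modulo `y` are closed under addition because `y ∣ 2`.
    have hadd : ∀ a b : An (2 ^ k), (yA (2 ^ k) ∣ a ∨ yA (2 ^ k) ∣ a - 1) →
        (yA (2 ^ k) ∣ b ∨ yA (2 ^ k) ∣ b - 1) → (yA (2 ^ k) ∣ a + b ∨ yA (2 ^ k) ∣ a + b - 1) := by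
      rintro a b (ha | ha) (hb | hb)
      · exact .inl (dvd_add ha hb)
      · exact .inr (by rw [add_sub_assoc]; exact dvd_add ha hb)
      · exact .inr (by rw [add_sub_right_comm]; exact dvd_add ha hb)
      · left
        rw [show a + b = (a - 1) + (b - 1) + 2 by ring]
        exact dvd_add (dvd_add ha hb) h2
    have hnat : ∀ j : ℕ, (yA (2 ^ k) ∣ (j : An (2 ^ k)) ∨ yA (2 ^ k) ∣ (j : An (2 ^ k)) - 1) := by
      intro j
      induction j with
      | zero => simp
      | succ j ih => rw [Nat.cast_succ]; exact hadd _ _ ih (by simp)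
    induction a using AdjoinRoot.induction_on with
    | ih p =>
      induction p using Polynomial.induction_on with
      | C a =>
        rw [AdjoinRoot.mk_C, ← ZMod.natCast_zmod_val a, map_natCast]
        exact hnat _
      | add p q hp hq => rw [map_add]; exact hadd _ _ hp hq
      | monomial j a h =>
        set z := AdjoinRoot.mk ((X : (ZMod 4)[X]) ^ 2 ^ k + 1) (C a * X ^ j)
        have hz : AdjoinRoot.mk ((X : (ZMod 4)[X]) ^ 2 ^ k + 1) (C a * X ^ (j + 1)) =
            z + (yA (2 ^ k) * z - 2 * z) := by
          rw [pow_succ, ← mul_assoc, map_mul, AdjoinRoot.mk_X, yA]; ring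
        rw [hz]
        exact hadd _ _ h (.inl (dvd_sub (dvd_mul_right _ _) (h2.mul_right _)))

/-! ### `Rₙ` as `A ⊕ uA`. -/

/-- The inclusion of `ℤ₄[x]/⟨xⁿ + 1⟩` into `R[x]/⟨xⁿ + 1⟩`. -/
noncomputable def incl (n : ℕ) : An n →+* Rn n :=
  AdjoinRoot.lift ((AdjoinRoot.of _).comp (algebraMap (ZMod 4) R)) (AdjoinRoot.root _) (by
    have := AdjoinRoot.eval₂_root ((X : R[X]) ^ n + 1)
    simpa using this)

@[simp] theorem incl_root (n : ℕ) : incl n (AdjoinRoot.root _) = AdjoinRoot.root _ := by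
  simp [incl]

@[simp] theorem incl_yA (n : ℕ) : incl n (yA n) = y n := by
  simp [yA, y]

/-- The projection of `R[x]/⟨xⁿ + 1⟩` onto the dual numbers over `ℤ₄[x]/⟨xⁿ + 1⟩`. -/
noncomputable def toDual (n : ℕ) : Rn n →+* DualNumber (An n) :=
  AdjoinRoot.lift (DualNumber.lift ⟨(Algebra.ofId (ZMod 4) (DualNumber (An n)), DualNumber.eps),
    DualNumber.eps_mul_eps, fun _ => Commute.all _ _⟩ : R →ₐ[ZMod 4] DualNumber (An n)).toRingHom
    (TrivSqZeroExt.inl (AdjoinRoot.root _)) (by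
    simp only [eval₂_add, eval₂_X_pow, eval₂_one]
    rw [TrivSqZeroExt.inl_pow, ← TrivSqZeroExt.inl_one, ← TrivSqZeroExt.inl_add, root_pow,
      TrivSqZeroExt.inl_zero])

theorem toDual_incl (n : ℕ) (a : An n) : toDual n (incl n a) = TrivSqZeroExt.inl a := by
  have : (toDual n).comp (incl n) = TrivSqZeroExt.inlHom (An n) (An n) := by
    apply AdjoinRoot.ringHom_ext
    · exact RingHom.ext_zmod _ _
    · simp [toDual]
  exact congrArg (fun g => g a) this

theorem toDual_u (n : ℕ) : toDual n (u n) = DualNumber.eps := by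
  simp [toDual, u]

theorem isDualExtension (n : ℕ) : IsDualExtension (incl n) (u n) where
  mul_self := by rw [u, ← map_mul, DualNumber.eps_mul_eps, map_zero]
  eq_zero {a c} h := by
    have := congrArg (toDual n) h
    rw [map_add, map_mul, toDual_incl, toDual_incl, toDual_u, map_zero] at this
    constructor
    · simpa using congrArg TrivSqZeroExt.fst this
    · simpa using congrArg TrivSqZeroExt.snd this
  exists_eq z := by
    induction z using AdjoinRoot.induction_on with
    | ih p =>
      induction p using Polynomial.induction_on with
      | C a =>
        refine ⟨AdjoinRoot.of _ a.fst, AdjoinRoot.of _ a.snd, ?_⟩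
        rw [AdjoinRoot.mk_C, incl, AdjoinRoot.lift_of, AdjoinRoot.lift_of, u, RingHom.comp_apply,
          RingHom.comp_apply, ← map_mul, ← map_add]
        congr 1
        ext <;> simp [TrivSqZeroExt.algebraMap_eq_inl]
      | add p q hp hq =>
        obtain ⟨a, c, h⟩ := hp
        obtain ⟨a', c', h'⟩ := hq
        refine ⟨a + a', c + c', ?_⟩
        rw [map_add, h, h', map_add, map_add]; ring
      | monomial j a h =>
        obtain ⟨b, c, h⟩ := h
        refine ⟨b * AdjoinRoot.root _, c * AdjoinRoot.root _, ?_⟩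
        rw [pow_succ, ← mul_assoc, map_mul, h, AdjoinRoot.mk_X, map_mul, map_mul, incl_root]; ring


/-! ### Digits in `A`, below and above position `n`. -/

/-- `n = 2ᵏ` with `k ≥ 1`. -/
def IsTwoPow (n : ℕ) : Prop := ∃ k, 1 ≤ k ∧ n = 2 ^ k

/-- The element of `ℤ₄[x]/⟨xⁿ + 1⟩` denoted by a binary polynomial in powers of `x + 1`. -/
noncomputable def liftA (n : ℕ) (h : (ZMod 2)[X]) : An n := binary (yA n) (taylor 1 h)

@[simp] theorem liftA_zero (n : ℕ) : liftA n 0 = 0 := by simp [liftA]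

@[simp] theorem incl_liftA (n : ℕ) (h : (ZMod 2)[X]) : incl n (liftA n h) = lift n h := by
  rw [liftA, map_binary, incl_yA, lift_eq_binary]

/-- `h(x)` has constant digit `1` in powers of `x + 1`. -/
def IsOdd (h : (ZMod 2)[X]) : Prop := (taylor 1 h).coeff 0 = 1

theorem IsOdd.ne_zero {h : (ZMod 2)[X]} (hh : IsOdd h) : h ≠ 0 := by
  rintro rfl; simp [IsOdd] at hh

@[simp] theorem not_isOdd_zero : ¬ IsOdd 0 := fun h => h.ne_zero rfl

/-- `(x + 1)ᵗ h(x)` is either zero, with `t = 0`, or has lowest digit in position `t` and highest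
digit below position `d`. -/
def IsDigits (t : ℕ) (h : (ZMod 2)[X]) (d : ℕ) : Prop :=
  h = 0 ∧ t = 0 ∨ IsOdd h ∧ t + h.natDegree < d

theorem IsDigits.mono {t d d' : ℕ} {h : (ZMod 2)[X]} (hd : IsDigits t h d) (hle : d ≤ d') :
    IsDigits t h d' :=
  hd.imp_right fun ⟨ho, hlt⟩ => ⟨ho, hlt.trans_le hle⟩

theorem IsDigits.zero_or {t d : ℕ} {h : (ZMod 2)[X]} (hd : IsDigits t h d) :
    h = 0 ∨ IsOdd h :=
  hd.imp And.left And.left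

theorem exists_taylor_eq (p : (ZMod 2)[X]) : ∃ h : (ZMod 2)[X], taylor 1 h = p :=
  ⟨taylor (-1) p, by rw [taylor_taylor]; exact taylor_zero p⟩

theorem X_pow_mul_inj {t t' : ℕ} {p p' : (ZMod 2)[X]} (hp : p.coeff 0 = 1) (hp' : p'.coeff 0 = 1)
    (h : X ^ t * p = X ^ t' * p') : t = t' ∧ p = p' := by
  have key : ∀ {t t' : ℕ} {p p' : (ZMod 2)[X]}, p.coeff 0 = 1 → X ^ t * p = X ^ t' * p' →
      t' ≤ t := by
    intro t t' p p' hp h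
    by_contra hlt
    have := congrArg (coeff · t) h
    simp [coeff_X_pow_mul', hp, hlt] at this
  obtain rfl := (key hp' h.symm).antisymm (key hp h)
  exact ⟨rfl, mul_left_cancel₀ (pow_ne_zero _ X_ne_zero) h⟩

theorem binary_X_pow_mul {A : Type*} [CommRing A] (y : A) (t : ℕ) (p : (ZMod 2)[X]) :
    binary y (X ^ t * p) = y ^ t * binary y p := by
  induction t with
  | zero => simp
  | succ t ih =>
    have := binary_C_add_X_mul (y := y) 0 (X ^ t * p)
    rw [C_0, zero_add, ZMod.val_zero, Nat.cast_zero, zero_add, ih, ← mul_assoc, ← mul_assoc,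
      ← pow_succ', ← pow_succ'] at this
    exact this

namespace IsTwoPow

variable {n : ℕ}

theorem one_le (hn : IsTwoPow n) : 1 ≤ n := by
  obtain ⟨k, hk, rfl⟩ := hn; exact Nat.one_le_two_pow

theorem unif (hn : IsTwoPow n) : IsBinaryUniformizer (yA n) (2 * n) := by
  obtain ⟨k, hk, rfl⟩ := hn; exact isBinaryUniformizer_yA hk

theorem exists_unit (hn : IsTwoPow n) : ∃ w : An n, IsUnit w ∧ yA n ^ n = 2 * w := by
  obtain ⟨k, hk, rfl⟩ := hn; exact exists_unit_yA_pow_eq hk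

theorem isUnitRep_iff (hn : IsTwoPow n) {h : (ZMod 2)[X]} :
    IsUnitRep n h ↔ h.natDegree < n ∧ IsOdd h := by
  obtain ⟨k, hk, rfl⟩ := hn; exact Negacyclic.isUnitRep_iff

theorem isUnit_liftA (hn : IsTwoPow n) {h : (ZMod 2)[X]} (hh : IsOdd h) : IsUnit (liftA n h) :=
  hn.unif.isUnit_binary hh

theorem pow_dvd_two_mul_iff (hn : IsTwoPow n) {d : ℕ} (hd : d ≤ n) (z : An n) :
    yA n ^ (n + d) ∣ 2 * z ↔ yA n ^ d ∣ z := by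
  obtain ⟨w, hw, h⟩ := hn.exists_unit
  have h1 : 2 * z * w = yA n ^ n * z := by rw [h]; ring
  rw [← hw.dvd_mul_right, h1]
  refine ⟨fun h => hn.unif.pow_dvd_of_pow_add_dvd (by omega) h, fun h => ?_⟩
  rw [pow_add]
  exact mul_dvd_mul_left _ h

theorem pow_dvd_two (hn : IsTwoPow n) : yA n ^ n ∣ 2 := by
  simpa using (hn.pow_dvd_two_mul_iff (d := 0) (by omega) 1).2 (by simp)

theorem two_eq (hn : IsTwoPow n) : ∃ w : An n, IsUnit w ∧ 2 = yA n ^ n * w := by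
  obtain ⟨_, ⟨w, rfl⟩, h⟩ := hn.exists_unit
  exact ⟨_, (w⁻¹).isUnit, by rw [h, mul_assoc, Units.mul_inv, mul_one]⟩

theorem digits_unique (hn : IsTwoPow n) {t t' d : ℕ} {h h' : (ZMod 2)[X]} (hd : d ≤ 2 * n)
    (ht : IsDigits t h d) (ht' : IsDigits t' h' d)
    (hdvd : yA n ^ d ∣ yA n ^ t * liftA n h - yA n ^ t' * liftA n h') : t = t' ∧ h = h' := by
  have hdeg : ∀ {t : ℕ} {h : (ZMod 2)[X]}, IsDigits t h d →
      (X ^ t * taylor 1 h).degree < (d : WithBot ℕ) := by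
    rintro t h (⟨rfl, rfl⟩ | ⟨hh, hlt⟩)
    · simp
    · refine lt_of_le_of_lt degree_le_natDegree (Nat.cast_lt.2 (lt_of_le_of_lt ?_ hlt))
      refine natDegree_mul_le.trans ?_
      rw [natDegree_X_pow, natDegree_taylor]
  have heq := hn.unif.binary_injective hd (hdeg ht) (hdeg ht')
    (by rw [binary_X_pow_mul, binary_X_pow_mul]; exact hdvd)
  rcases ht with ⟨rfl, rfl⟩ | ⟨hh, -⟩
  · rcases ht' with ⟨rfl, rfl⟩ | ⟨hh', -⟩
    · exact ⟨rfl, rfl⟩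
    · have h0 : taylor 1 h' = 0 := by simpa using heq.symm
      rw [IsOdd, h0] at hh'
      simp at hh'
  · rcases ht' with ⟨rfl, rfl⟩ | ⟨hh', -⟩
    · have h0 : taylor 1 h = 0 := by simpa using heq
      rw [IsOdd, h0] at hh
      simp at hh
    · have := X_pow_mul_inj hh hh' heq
      exact ⟨this.1, taylor_injective 1 this.2⟩

/-- Modulo `yⁿ` the terms with factor 2 vanish, which fixes the low digits; then 2 is cancelled at
the cost of `n` powers of `y`. -/
theorem two_level_unique (hn : IsTwoPow n) {t t' d : ℕ} {h h' : (ZMod 2)[X]} {z z' : An n}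
    (hd : d ≤ n) (ht : IsDigits t h n) (ht' : IsDigits t' h' n)
    (hdvd : yA n ^ (n + d) ∣
      (2 * z + yA n ^ t * liftA n h) - (2 * z' + yA n ^ t' * liftA n h')) :
    t = t' ∧ h = h' ∧ yA n ^ d ∣ z - z' := by
  have h1 : yA n ^ n ∣ yA n ^ t * liftA n h - yA n ^ t' * liftA n h' := by
    have := dvd_sub ((pow_dvd_pow (yA n) (Nat.le_add_right n d)).trans hdvd)
      (hn.pow_dvd_two.mul_right (z - z'))
    convert this using 1
    ring
  obtain ⟨rfl, rfl⟩ := hn.digits_unique (by omega) ht ht' h1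
  refine ⟨rfl, rfl, ?_⟩
  rw [← hn.pow_dvd_two_mul_iff hd]
  convert hdvd using 1
  ring

/-- Separates Type 2.1 from Type 2.3: the latter has a digit at position `n + t' < m`, whereas the
former has all its digits below `n`. -/
theorem not_pow_dvd_sub_mix (hn : IsTwoPow n) {t t' a m : ℕ} {h h₁ h₂ : (ZMod 2)[X]}
    (ht : IsDigits t h n) (h₁_odd : IsOdd h₁) (ha : IsDigits a h₂ n) (hlt : n + t' < m)
    (hm : m ≤ 2 * n) :
    ¬ yA n ^ m ∣ yA n ^ t * liftA n h -
      (2 * (yA n ^ t' * liftA n h₁) + yA n ^ a * liftA n h₂) := by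
  intro hdvd
  obtain ⟨-, -, h0⟩ := hn.two_level_unique (d := m - n) (z := 0) (z' := yA n ^ t' * liftA n h₁)
    (by omega) ht ha (by rwa [mul_zero, zero_add, Nat.add_sub_cancel' (by omega)])
  rw [zero_sub, dvd_neg, hn.unif.pow_dvd_iff (by omega) (hn.isUnit_liftA h₁_odd)] at h0
  omega

theorem exists_digits (hn : IsTwoPow n) {t d : ℕ} (h : t < d) {c : An n} (hc : IsUnit c) :
    ∃ h : (ZMod 2)[X], IsOdd h ∧ t + h.natDegree < d ∧
      yA n ^ d ∣ yA n ^ t * c - yA n ^ t * liftA n h := by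
  obtain ⟨p, hp, h0, e, he⟩ := hn.unif.exists_binary_of_isUnit (d := d - t) (by omega)
    (by have := hn.one_le; omega) hc
  obtain ⟨g, rfl⟩ := exists_taylor_eq p
  rw [natDegree_taylor] at hp
  refine ⟨g, h0, by omega, e, ?_⟩
  rw [← mul_sub, liftA, he, ← mul_assoc, ← pow_add]
  congr 2
  omega

end IsTwoPow

/-! ### Invariants of the listed generators, and the values of `T` and `T₁`. -/

section gens

variable {n : ℕ}

theorem gen_eq (s t : ℕ) (h : (ZMod 2)[X]) :
    gen n s t h = incl n (yA n ^ s) + u n * incl n (yA n ^ t * liftA n h) := by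
  simp [gen]; ring

theorem genTwo_eq (s t : ℕ) (h : (ZMod 2)[X]) :
    genTwo n s t h = incl n (yA n ^ s) + u n * incl n (2 * (yA n ^ t * liftA n h)) := by
  simp only [genTwo, map_mul, map_pow, incl_yA, incl_liftA, map_ofNat]; ring

theorem genMix_eq (s t l : ℕ) (h₁ h₂ : (ZMod 2)[X]) :
    genMix n s t l h₁ h₂ = incl n (yA n ^ s) +
      u n * incl n (2 * (yA n ^ t * liftA n h₁) + yA n ^ (t + l) * liftA n h₂) := by
  simp only [genMix, map_mul, map_pow, map_add, incl_yA, incl_liftA, map_ofNat]; ring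

theorem minT_eq (hn : IsTwoPow n) {g : Rn n} {s m : ℕ} {b : An n}
    (h : HasInvariants (incl n) (u n) (yA n) (2 * n) (Ideal.span {g}) s m b) : minT g = m := by
  have hset : {T : ℕ | u n * y n ^ T ∈ Ideal.span {g}} = Set.Ici m := by
    ext T
    rw [Set.mem_ofPred_eq, ← incl_yA, ← map_pow, h.u_mul_mem_iff hn.unif (isDualExtension n),
      ← mul_one (yA n ^ T), hn.unif.pow_dvd_iff (h.m_le.trans h.s_le) isUnit_one, Set.mem_Ici]
  rw [minT, hset, csInf_Ici]

theorem minT₁_eq (hn : IsTwoPow n) {g : Rn n} {s m : ℕ} {b : An n}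
    (h : HasInvariants (incl n) (u n) (yA n) (2 * n) (Ideal.span {g}) s m b) :
    minT₁ g = m - n := by
  have hset : {T : ℕ | 2 * u n * y n ^ T ∈ Ideal.span {g}} = Set.Ici (m - n) := by
    ext T
    obtain ⟨w, hw, h2⟩ := hn.two_eq
    -- The factor 2 counts as `yⁿ`, so `T₁` is `m - n`, truncated at 0.
    have : 2 * u n * y n ^ T = u n * incl n (yA n ^ (n + T) * w) := by
      rw [pow_add, mul_right_comm (yA n ^ n), ← h2, map_mul, map_pow, incl_yA, map_ofNat]; ring
    rw [Set.mem_ofPred_eq, this, h.u_mul_mem_iff hn.unif (isDualExtension n),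
      hn.unif.pow_dvd_iff (h.m_le.trans h.s_le) hw, Set.mem_Ici]
    omega
  rw [minT₁, hset, csInf_Ici]

/-- The `(x + 1)`-adic valuation of `(x + 1)ᵗ h(x)`, for `h` zero or a unit. -/
noncomputable def valDigits (n t : ℕ) (h : (ZMod 2)[X]) : ℕ :=
  open Classical in if h = 0 then 2 * n else t

theorem valDigits_zero (t : ℕ) : valDigits n t 0 = 2 * n := by simp [valDigits]

theorem isDigits_iff {t d : ℕ} {h : (ZMod 2)[X]} : IsDigits t h d ↔
    (h = 0 ∧ t = 0 ∧ valDigits n t h = 2 * n) ∨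
      (IsOdd h ∧ valDigits n t h = t ∧ t + h.natDegree < d) := by
  by_cases hh : h = 0
  · subst hh; simp [IsDigits, valDigits]
  · simp [IsDigits, valDigits, hh]

theorem valDigits_of_ne {t : ℕ} {h : (ZMod 2)[X]} (hh : h ≠ 0) : valDigits n t h = t := by
  simp [valDigits, hh]

theorem exists_unit_pow_mul_liftA (hn : IsTwoPow n) {t : ℕ} {h : (ZMod 2)[X]}
    (hh : h = 0 ∨ IsOdd h) :
    ∃ c, IsUnit c ∧ yA n ^ t * liftA n h = yA n ^ valDigits n t h * c := by
  rcases hh with rfl | hh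
  · exact ⟨1, isUnit_one, by simp [valDigits_zero, hn.unif.pow_eq_zero]⟩
  · exact ⟨_, hn.isUnit_liftA hh, by rw [valDigits_of_ne hh.ne_zero]⟩

theorem exists_unit_two_mul (hn : IsTwoPow n) {t : ℕ} {h : (ZMod 2)[X]} (hh : IsOdd h) :
    ∃ c, IsUnit c ∧ 2 * (yA n ^ t * liftA n h) = yA n ^ (n + t) * c := by
  obtain ⟨w, hw, h2⟩ := hn.two_eq
  exact ⟨_, hw.mul (hn.isUnit_liftA hh), by rw [h2]; ring⟩

/-- As `l < n`, the second term dominates the first, whose valuation is at least `n + t`. -/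
theorem exists_unit_mix (hn : IsTwoPow n) {t l : ℕ} (hl : l < n) {h₁ h₂ : (ZMod 2)[X]}
    (hh : IsOdd h₂) : ∃ c, IsUnit c ∧
      2 * (yA n ^ t * liftA n h₁) + yA n ^ (t + l) * liftA n h₂ = yA n ^ (t + l) * c := by
  obtain ⟨w, hw, h2⟩ := hn.two_eq
  refine ⟨_, hn.unif.isUnit_add (hn.isUnit_liftA hh) (yA n ^ (n - l - 1) * w * liftA n h₁), ?_⟩
  have h3 : yA n ^ n = yA n ^ l * yA n * yA n ^ (n - l - 1) := by
    rw [← pow_succ, ← pow_add]; congr 1; omega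
  rw [h2, h3, pow_add]; ring

theorem hasInvariants_gen (hn : IsTwoPow n) {s t : ℕ} {h : (ZMod 2)[X]} (hs : s ≤ 2 * n)
    (hh : h = 0 ∨ IsOdd h) :
    HasInvariants (incl n) (u n) (yA n) (2 * n) (Ideal.span {gen n s t h}) s
      (min s (2 * n - s + valDigits n t h)) (yA n ^ t * liftA n h) := by
  obtain ⟨c, hc, hb⟩ := exists_unit_pow_mul_liftA hn (t := t) hh
  rw [gen_eq]
  exact hasInvariants_span_singleton hn.unif (isDualExtension n) hs hc hb

theorem hasInvariants_genTwo (hn : IsTwoPow n) {s t : ℕ} {h : (ZMod 2)[X]} (hs : s ≤ 2 * n)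
    (hh : IsOdd h) :
    HasInvariants (incl n) (u n) (yA n) (2 * n) (Ideal.span {genTwo n s t h}) s
      (min s (2 * n - s + (n + t))) (2 * (yA n ^ t * liftA n h)) := by
  obtain ⟨c, hc, hb⟩ := exists_unit_two_mul hn (t := t) hh
  rw [genTwo_eq]
  exact hasInvariants_span_singleton hn.unif (isDualExtension n) hs hc hb

theorem hasInvariants_genMix (hn : IsTwoPow n) {s t l : ℕ} {h₁ h₂ : (ZMod 2)[X]} (hs : s ≤ 2 * n)
    (hl : l < n) (hh : IsOdd h₂) :
    HasInvariants (incl n) (u n) (yA n) (2 * n) (Ideal.span {genMix n s t l h₁ h₂}) s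
      (min s (2 * n - s + (t + l)))
      (2 * (yA n ^ t * liftA n h₁) + yA n ^ (t + l) * liftA n h₂) := by
  obtain ⟨c, hc, hb⟩ := exists_unit_mix hn (t := t) hl (h₁ := h₁) hh
  rw [genMix_eq]
  exact hasInvariants_span_singleton hn.unif (isDualExtension n) hs hc hb

end gens

/-! ### The types as normal forms. -/

namespace Param

variable {n : ℕ}

/-- The exponent of the residue ideal of the code, for the types that list every code once. -/
def resExp (n : ℕ) : Param → ℕ
  | one => 0
  | type20 s _ _ | type21 s _ _ | type22 s _ _ | type23 s _ _ _ _ | type30 s _ _ _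
  | type31 s _ _ _ | type33 s _ _ _ => s
  -- Codes inside `⟨u⟩` have zero residue ideal, that is `⟨y^(2n)⟩`. Types 3.2, 3.4 and 3.5 also
  -- land here, but `Canonical` excludes them.
  | _ => 2 * n

/-- The exponent of the torsion ideal of the code. -/
noncomputable def torExp (n : ℕ) : Param → ℕ
  | one => 0
  | type1 m => m
  | type20 s t h | type21 s t h => min s (2 * n - s + valDigits n t h)
  | type22 s t _ => min s (2 * n - s + (n + t))
  | type23 s t l _ _ => min s (2 * n - s + (t + l))
  | type30 _ _ m _ | type31 _ _ m _ => m
  | type33 _ _ m _ => n + m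
  | _ => 2 * n

/-- The element `b` in the first generator `(x + 1)ˢ + ub` of the code. -/
noncomputable def offset (n : ℕ) : Param → An n
  | type20 _ t h | type21 _ t h | type30 _ t _ h | type31 _ t _ h => yA n ^ t * liftA n h
  | type22 _ t h | type33 _ t _ h => 2 * (yA n ^ t * liftA n h)
  | type23 _ t l h₁ h₂ => 2 * (yA n ^ t * liftA n h₁) + yA n ^ (t + l) * liftA n h₂
  | _ => 0

/-- The `(x + 1)`-adic valuation of the offset. -/
noncomputable def val (n : ℕ) : Param → ℕ
  | type20 _ t h | type21 _ t h | type30 _ t _ h | type31 _ t _ h => valDigits n t h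
  | type22 _ t _ | type33 _ t _ _ => n + t
  | type23 _ t l _ _ => t + l
  | _ => 2 * n

/-- The normalized parameter ranges, with `T` and `T₁` computed. -/
def Canonical (n : ℕ) : Param → Prop
  | zero | one => True
  | type1 m => m < 2 * n
  | type20 s t h => 1 ≤ s ∧ s < n ∧ IsDigits t h s
  | type21 s t h =>
      n ≤ s ∧ s < 2 * n ∧ IsDigits t h (min n (min s (2 * n - s + valDigits n t h)))
  | type22 s t h =>
      n ≤ s ∧ s < 2 * n ∧ IsOdd h ∧ n + t + h.natDegree < min s (2 * n - s + (n + t))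
  | type23 s t l h₁ h₂ =>
      n ≤ s ∧ s < 2 * n ∧ IsOdd h₁ ∧ IsOdd h₂ ∧
      n + t + h₁.natDegree < min s (2 * n - s + (t + l)) ∧ t + l + h₂.natDegree < n
  | type30 s t m h => 1 ≤ s ∧ s < n ∧ m < s ∧ IsDigits t h m
  | type31 s t m h =>
      n ≤ s ∧ s < 2 * n ∧ t < n ∧ m < min s (2 * n - s + valDigits n t h) ∧ IsDigits t h m
  | type33 s t m h =>
      n ≤ s ∧ s < 2 * n ∧ n + m < min s (2 * n - s + (n + t)) ∧ IsOdd h ∧ t + h.natDegree < m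
  | _ => False

theorem canonical_iff (hn : IsTwoPow n) (p : Param) :
    p.Admissible n ∧ p.Normalized ↔ p.Canonical n := by
  have h1 := hn.one_le
  rcases p with _ | _ | m | ⟨s, t, h⟩ | ⟨s, t, h⟩ | ⟨s, t, h⟩ | ⟨s, t, l, h₁, h₂⟩ | ⟨s, t, m, h⟩ |
    ⟨s, t, m, h⟩ | ⟨s, t, m, h⟩ | ⟨s, t, m, h⟩ | ⟨s, t, l, m, h₁, h₂⟩ | ⟨s, t, l, m, h₁, h₂⟩
  · simp [Admissible, Normalized, Canonical]
  · simp [Admissible, Normalized, Canonical]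
  · simp only [Admissible, Normalized, Canonical, and_true]; omega
  · simp only [Admissible, Normalized, Canonical, IsDigits, hn.isUnitRep_iff]
    by_cases hh : h = 0
    · subst hh
      simp
      omega
    · by_cases ho : IsOdd h
      · simp [hh, ho]
        omega
      · simp [hh, ho]
  · simp only [Admissible, Normalized, Canonical, IsDigits, hn.isUnitRep_iff]
    by_cases hh : h = 0
    · subst hh
      simp [valDigits_zero]
      omega
    · by_cases ho : IsOdd h
      · simp [hh, ho, valDigits_of_ne hh]
        split_ifs <;> omega
      · simp [hh, ho]
  · simp only [Admissible, Normalized, Canonical, hn.isUnitRep_iff]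
    by_cases ho : IsOdd h
    · simp [ho]
      split_ifs <;> omega
    · simp [ho]
  · simp only [Admissible, Normalized, Canonical, hn.isUnitRep_iff]
    by_cases ho : IsOdd h₁
    · by_cases ho' : IsOdd h₂
      · simp [ho, ho']
        -- `T₁` is computed only in this range; outside it both sides are false.
        by_cases hc : s ≤ 2 * n ∧ l < n
        · rw [minT₁_eq hn (hasInvariants_genMix hn hc.1 hc.2 ho')]
          omega
        · omega
      · simp [ho']
    · simp [ho]
  · simp only [Admissible, Normalized, Canonical, IsDigits, hn.isUnitRep_iff]
    by_cases hh : h = 0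
    · subst hh
      simp
      omega
    · by_cases ho : IsOdd h
      · simp [hh, ho]
        omega
      · simp [hh, ho]
  · simp only [Admissible, Normalized, Canonical, IsDigits, hn.isUnitRep_iff]
    by_cases hh : h = 0
    · subst hh
      simp [valDigits_zero]
      by_cases hc : s ≤ 2 * n
      · rw [minT_eq hn (hasInvariants_gen hn hc (.inl rfl)), valDigits_zero]
        omega
      · omega
    · by_cases ho : IsOdd h
      · simp [hh, ho, valDigits_of_ne hh]
        by_cases hc : s ≤ 2 * n
        · rw [minT_eq hn (hasInvariants_gen hn hc (.inr ho)), valDigits_of_ne hh]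
          omega
        · omega
      · simp [hh, ho]
  · simp [Normalized, Canonical]
  · simp only [Admissible, Normalized, Canonical, hn.isUnitRep_iff]
    by_cases ho : IsOdd h
    · simp [ho]
      by_cases hc : s ≤ 2 * n
      · rw [minT₁_eq hn (hasInvariants_genTwo hn hc ho)]
        omega
      · omega
    · simp [ho]
  · simp [Normalized, Canonical]
  · simp [Normalized, Canonical]

theorem Canonical.exists_unit (hn : IsTwoPow n) {p : Param} (hp : p.Canonical n) :
    ∃ c, IsUnit c ∧ p.offset n = yA n ^ p.val n * c := by
  have h0 : ∃ c : An n, IsUnit c ∧ 0 = yA n ^ (2 * n) * c :=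
    ⟨1, isUnit_one, by rw [hn.unif.pow_eq_zero, zero_mul]⟩
  rcases p with _ | _ | m | ⟨s, t, h⟩ | ⟨s, t, h⟩ | ⟨s, t, h⟩ | ⟨s, t, l, h₁, h₂⟩ | ⟨s, t, m, h⟩ |
    ⟨s, t, m, h⟩ | ⟨s, t, m, h⟩ | ⟨s, t, m, h⟩ | ⟨s, t, l, m, h₁, h₂⟩ | ⟨s, t, l, m, h₁, h₂⟩ <;>
    simp only [Canonical] at hp <;> simp only [offset, val]
  · exact h0
  · exact h0
  · exact h0
  · exact exists_unit_pow_mul_liftA hn hp.2.2.zero_or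
  · exact exists_unit_pow_mul_liftA hn hp.2.2.zero_or
  · exact exists_unit_two_mul hn hp.2.2.1
  · exact exists_unit_mix hn (by omega) hp.2.2.2.1
  · exact exists_unit_pow_mul_liftA hn hp.2.2.2.zero_or
  · exact exists_unit_pow_mul_liftA hn hp.2.2.2.2.zero_or
  · exact exists_unit_two_mul hn hp.2.2.2.1

/-- `Associated` lets the generator `2uy^m₁` of Type 3.3 stand for `uy^(n+m₁)`. -/
theorem hasInvariants_pair {s m v : ℕ} {b c : An n}
    (hb : b = yA n ^ v * c) (hs : s ≤ 2 * n) (hm : m ≤ min s (2 * n - s + v)) {g t : Rn n}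
    (hg : g = incl n (yA n ^ s) + u n * incl n b) (ht : Associated t (u n * incl n (yA n ^ m))) :
    HasInvariants (incl n) (u n) (yA n) (2 * n) (Ideal.span {g, t}) s m b where
  eq_span := by
    obtain ⟨w, hw⟩ := ht
    rw [hg, Ideal.span_insert, Ideal.span_insert, ← hw,
      Ideal.span_singleton_mul_right_unit w.isUnit]
  m_le := by omega
  s_le := hs
  dvd := by
    rw [hb, ← mul_assoc, ← pow_add]
    exact (pow_dvd_pow _ (by omega)).mul_right c

theorem Canonical.hasInvariants (hn : IsTwoPow n) {p : Param} (hp : p.Canonical n) :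
    HasInvariants (incl n) (u n) (yA n) (2 * n) (p.code n) (p.resExp n) (p.torExp n)
      (p.offset n) := by
  obtain ⟨c, hc, hb⟩ := hp.exists_unit hn
  have hu : ∀ m, u n * y n ^ m = u n * incl n (yA n ^ m) := by simp
  have hz : y n ^ (2 * n) = 0 := by rw [← incl_yA, ← map_pow, hn.unif.pow_eq_zero, map_zero]
  have h1 := hn.one_le
  rcases p with _ | _ | m | ⟨s, t, h⟩ | ⟨s, t, h⟩ | ⟨s, t, h⟩ | ⟨s, t, l, h₁, h₂⟩ | ⟨s, t, m, h⟩ |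
    ⟨s, t, m, h⟩ | ⟨s, t, m, h⟩ | ⟨s, t, m, h⟩ | ⟨s, t, l, m, h₁, h₂⟩ | ⟨s, t, l, m, h₁, h₂⟩ <;>
    simp only [Canonical] at hp <;> simp only [offset, val, resExp, torExp, code] at hb ⊢
  · refine ⟨?_, le_rfl, le_rfl, by simp⟩
    simp [hz]
  · refine ⟨?_, le_rfl, by omega, by simp⟩
    rw [eq_comm, Ideal.span_insert, eq_comm]; simp
  · refine ⟨?_, hp.le, le_rfl, by simp⟩
    simp [hz, Ideal.span_insert]
  · exact hasInvariants_gen hn (by omega) hp.2.2.zero_or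
  · exact hasInvariants_gen hn (by omega) hp.2.2.zero_or
  · exact hasInvariants_genTwo hn (by omega) hp.2.2.1
  · exact hasInvariants_genMix hn (by omega) (by omega) hp.2.2.2.1
  · exact hasInvariants_pair hb (by omega) (by omega) (gen_eq _ _ _)
      (by rw [hu])
  · exact hasInvariants_pair hb (by omega) (by omega) (gen_eq _ _ _)
      (by rw [hu])
  · refine hasInvariants_pair hb (by omega) (by omega) (genTwo_eq _ _ _) ?_
    obtain ⟨w, ⟨w, rfl⟩, h2⟩ := hn.exists_unit
    refine ⟨w.map (incl n : An n →* Rn n), ?_⟩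
    rw [pow_add, h2, Units.coe_map, MonoidHom.coe_coe]
    simp only [map_mul, map_pow, incl_yA, map_ofNat]; ring

end Param
-- Uniqueness of the parameters.
namespace Param
variable {n : ℕ}

theorem Canonical.eq_of_invariants_eq (hn : IsTwoPow n) {p q : Param} (hp : p.Canonical n)
    (hq : q.Canonical n) (hs : p.resExp n = q.resExp n) (hm : p.torExp n = q.torExp n)
    (hb : yA n ^ p.torExp n ∣ p.offset n - q.offset n) : p = q := by
  have h1 := hn.one_le
  have hv : min (p.val n) (p.torExp n) = min (q.val n) (p.torExp n) := by
    obtain ⟨c, hc, h⟩ := hp.exists_unit hn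
    obtain ⟨c', hc', h'⟩ := hq.exists_unit hn
    rw [h, h'] at hb
    have := hp.hasInvariants hn
    exact hn.unif.min_val_eq (this.m_le.trans this.s_le) hc hc' hb
  rcases p with _ | _ | m | ⟨s, t, h⟩ | ⟨s, t, h⟩ | ⟨s, t, h⟩ | ⟨s, t, l, h₁, h₂⟩ | ⟨s, t, m, h⟩ |
    ⟨s, t, m, h⟩ | ⟨s, t, m, h⟩ | ⟨s, t, m, h⟩ | ⟨s, t, l, m, h₁, h₂⟩ | ⟨s, t, l, m, h₁, h₂⟩ <;>
  simp only [Canonical] at hp <;>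
  rcases q with _ | _ | m' | ⟨s', t', h'⟩ | ⟨s', t', h'⟩ | ⟨s', t', h'⟩ | ⟨s', t', l', h₁', h₂'⟩ |
    ⟨s', t', m', h'⟩ | ⟨s', t', m', h'⟩ | ⟨s', t', m', h'⟩ | ⟨s', t', m', h'⟩ |
    ⟨s', t', l', m', h₁', h₂'⟩ | ⟨s', t', l', m', h₁', h₂'⟩ <;>
  simp only [Canonical] at hq <;>
  simp only [resExp, torExp, val, offset] at hs hm hv hb <;>
  -- Comparing `s`, `m` and the truncated valuations rules out all pairs of distinct types except
  -- 2.1 against 2.3.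
  try (exfalso; (try simp only [isDigits_iff (n := n)] at hp hq); omega)
  · rfl
  · rfl
  · rw [hm]
  · subst hs
    obtain ⟨rfl, rfl⟩ := hn.digits_unique (by omega) hp.2.2 hq.2.2
      ((pow_dvd_pow _ (by omega)).trans hb)
    rfl
  · subst hs
    -- The two digit bounds involve different valuations; equality of the torsion exponents makes
    -- them the same bound.
    rw [← hm] at hq
    obtain ⟨rfl, rfl⟩ := hn.digits_unique (by omega) hp.2.2 hq.2.2
      ((pow_dvd_pow _ (min_le_right _ _)).trans hb)
    rfl
  · exact absurd hb (hn.not_pow_dvd_sub_mix (hp.2.2.mono (min_le_left _ _)) hq.2.2.1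
      (.inr ⟨hq.2.2.2.1, hq.2.2.2.2.2⟩) (by omega) (by omega))
  · subst hs
    obtain ⟨d, hd⟩ : ∃ d, min s (2 * n - s + (n + t)) = n + d := Nat.exists_eq_add_of_le (by omega)
    rw [hd, ← mul_sub, hn.pow_dvd_two_mul_iff (by omega)] at hb
    obtain ⟨rfl, rfl⟩ := hn.digits_unique (by omega) (.inr ⟨hp.2.2.1, by omega⟩)
      (.inr ⟨hq.2.2.1, by omega⟩) hb
    rfl
  · rw [dvd_sub_comm] at hb
    exact absurd hb (hn.not_pow_dvd_sub_mix (hq.2.2.mono (min_le_left _ _)) hp.2.2.1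
      (.inr ⟨hp.2.2.2.1, hp.2.2.2.2.2⟩) (by omega) (by omega))
  · subst hs
    obtain ⟨d, hd⟩ : ∃ d, min s (2 * n - s + (t + l)) = n + d := Nat.exists_eq_add_of_le (by omega)
    rw [hd] at hb
    obtain ⟨htl, rfl, hz⟩ := hn.two_level_unique (by omega)
      (.inr ⟨hp.2.2.2.1, hp.2.2.2.2.2⟩) (.inr ⟨hq.2.2.2.1, hq.2.2.2.2.2⟩) hb
    obtain ⟨rfl, rfl⟩ := hn.digits_unique (by omega) (.inr ⟨hp.2.2.1, by omega⟩)
      (.inr ⟨hq.2.2.1, by omega⟩) hz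
    rw [Nat.add_left_cancel htl]
  · subst hs hm
    obtain ⟨rfl, rfl⟩ := hn.digits_unique (by omega) hp.2.2.2 hq.2.2.2 hb
    rfl
  · subst hs hm
    obtain ⟨rfl, rfl⟩ := hn.digits_unique (by omega) hp.2.2.2.2 hq.2.2.2.2 hb
    rfl
  · obtain rfl := Nat.add_left_cancel hm
    subst hs
    rw [← mul_sub, hn.pow_dvd_two_mul_iff (by omega)] at hb
    obtain ⟨rfl, rfl⟩ := hn.digits_unique (by omega) (.inr hp.2.2.2) (.inr hq.2.2.2) hb
    rfl


/-! ### Every triple of invariants occurs. -/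

theorem exists_canonical_of_lt (hn : IsTwoPow n) {s m v : ℕ} {c : An n} (hc : IsUnit c)
    (hs : 1 ≤ s) (hsn : s < n) (hm : m ≤ s) :
    ∃ p : Param, p.Canonical n ∧ p.resExp n = s ∧ p.torExp n = m ∧
      yA n ^ m ∣ yA n ^ v * c - p.offset n := by
  obtain ⟨t, h, hd, hdvd⟩ : ∃ t h, IsDigits t h m ∧
      yA n ^ m ∣ yA n ^ v * c - yA n ^ t * liftA n h := by
    rcases lt_or_ge v m with hv | hv
    · obtain ⟨h, ho, hlt, hdvd⟩ := hn.exists_digits hv hc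
      exact ⟨v, h, .inr ⟨ho, hlt⟩, hdvd⟩
    · exact ⟨0, 0, .inl ⟨rfl, rfl⟩, by simpa using (pow_dvd_pow _ hv).mul_right c⟩
  rcases hm.lt_or_eq with hlt | rfl
  · exact ⟨type30 s t m h, ⟨hs, hsn, hlt, hd⟩, rfl, rfl, hdvd⟩
  · exact ⟨type20 m t h, ⟨hs, hsn, hd⟩, rfl, by simp only [torExp]; omega, hdvd⟩

/-- The digits of `b` below `n` form `h`, and the rest is `2we`. Modulo `yᵐ` the rest is visible
exactly when the valuation of `we` is below `m - n`: this gives Type 2.3, and otherwise Type 2.1. -/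
theorem exists_canonical_principal (hn : IsTwoPow n) {s v : ℕ} {c : An n} (hc : IsUnit c)
    (hs : n ≤ s) (hsn : s < 2 * n) (hv : v < n) (hm : n < min s (2 * n - s + v)) :
    ∃ p : Param, p.Canonical n ∧ p.resExp n = s ∧ p.torExp n = min s (2 * n - s + v) ∧
      yA n ^ min s (2 * n - s + v) ∣ yA n ^ v * c - p.offset n := by
  obtain ⟨m, hm'⟩ : ∃ m, min s (2 * n - s + v) = n + m := ⟨_, (Nat.add_sub_cancel' hm.le).symm⟩
  obtain ⟨h, ho, hlt, e, he⟩ := hn.exists_digits hv hc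
  obtain ⟨w, hw, hw2⟩ := hn.exists_unit
  have hb : yA n ^ v * c = yA n ^ v * liftA n h + 2 * (w * e) := by
    rw [← mul_assoc, ← hw2, ← he]; ring
  obtain ⟨t, -, c', hc', he'⟩ := hn.unif.exists_unit (w * e)
  rcases lt_or_ge t m with ht | ht
  · obtain ⟨h₁, ho₁, hlt₁, hdvd⟩ := hn.exists_digits ht hc'
    -- The subtraction is not truncated: `s ≥ n` gives `n + m ≤ 2n - s + v ≤ n + v`, hence `t < m ≤
    -- v`.
    have hvt : t + (v - t) = v := by omega
    refine ⟨type23 s t (v - t) h₁ h, ⟨hs, hsn, ho₁, ho, by omega, by omega⟩, rfl, ?_, ?_⟩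
    · simp only [torExp, hvt]
    · simp only [offset, hvt]
      rw [hb, he', hm', add_comm (yA n ^ v * _), add_sub_add_right_eq_sub, ← mul_sub,
        hn.pow_dvd_two_mul_iff (by omega)]
      exact hdvd
  · refine ⟨type21 s v h, ⟨hs, hsn, .inr ⟨ho, ?_⟩⟩, rfl, ?_, ?_⟩
    · rw [valDigits_of_ne ho.ne_zero]; omega
    · simp only [torExp, valDigits_of_ne ho.ne_zero]
    · simp only [offset]
      rw [hb, he', hm', add_sub_cancel_left, hn.pow_dvd_two_mul_iff (by omega)]
      exact (pow_dvd_pow _ ht).mul_right c'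

/-- If `m ≤ v`, then `b` may be replaced by 0. Otherwise the type depends on whether `v < n` (no
overall factor 2) and on whether `m` attains its bound (one generator). -/
theorem exists_canonical_of_ge (hn : IsTwoPow n) {s m v : ℕ} {c : An n} (hc : IsUnit c)
    (hs : n ≤ s) (hsn : s < 2 * n) (hm : m ≤ min s (2 * n - s + v)) :
    ∃ p : Param, p.Canonical n ∧ p.resExp n = s ∧ p.torExp n = m ∧
      yA n ^ m ∣ yA n ^ v * c - p.offset n := by
  have h1 := hn.one_le
  rcases le_or_gt m v with hmv | hmv
  · have hdvd : yA n ^ m ∣ yA n ^ v * c - yA n ^ 0 * liftA n 0 := by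
      simpa using (pow_dvd_pow _ hmv).mul_right c
    by_cases hms : m = s
    · exact ⟨type21 s 0 0, ⟨hs, hsn, .inl ⟨rfl, rfl⟩⟩, rfl,
        by simp only [torExp, valDigits_zero]; omega, hdvd⟩
    · exact ⟨type31 s 0 m 0, ⟨hs, hsn, by omega, by rw [valDigits_zero]; omega,
        .inl ⟨rfl, rfl⟩⟩, rfl, rfl, hdvd⟩
  rcases lt_or_ge v n with hvn | hvn
  · rcases hm.lt_or_eq with hlt | rfl
    · obtain ⟨h, ho, hh, hdvd⟩ := hn.exists_digits hmv hc
      exact ⟨type31 s v m h, ⟨hs, hsn, hvn, by rwa [valDigits_of_ne ho.ne_zero],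
        .inr ⟨ho, hh⟩⟩, rfl, rfl, hdvd⟩
    · rcases lt_or_ge n (min s (2 * n - s + v)) with hmn | hmn
      · exact exists_canonical_principal hn hc hs hsn hvn hmn
      · obtain ⟨h, ho, hh, hdvd⟩ := hn.exists_digits hmv hc
        refine ⟨type21 s v h, ⟨hs, hsn, .inr ⟨ho, ?_⟩⟩, rfl, ?_, hdvd⟩
        · rw [valDigits_of_ne ho.ne_zero]; omega
        · simp only [torExp, valDigits_of_ne ho.ne_zero]
  · obtain ⟨w, hw, hw2⟩ := hn.exists_unit
    obtain ⟨t, rfl⟩ := Nat.exists_eq_add_of_le hvn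
    obtain ⟨d, rfl⟩ : ∃ d, m = n + d := ⟨m - n, by omega⟩
    obtain ⟨h, ho, hh, hdvd⟩ := hn.exists_digits (t := t) (d := d) (by omega) (hw.mul hc)
    have hdvd' : yA n ^ (n + d) ∣ yA n ^ (n + t) * c - 2 * (yA n ^ t * liftA n h) := by
      have : yA n ^ (n + t) * c = 2 * (yA n ^ t * (w * c)) := by rw [pow_add, hw2]; ring
      rw [this, ← mul_sub, hn.pow_dvd_two_mul_iff (by omega)]
      exact hdvd
    rcases hm.lt_or_eq with hlt | heq
    · exact ⟨type33 s t d h, ⟨hs, hsn, hlt, ho, hh⟩, rfl, rfl, hdvd'⟩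
    · exact ⟨type22 s t h, ⟨hs, hsn, ho, by omega⟩, rfl, heq.symm, hdvd'⟩

theorem exists_canonical (hn : IsTwoPow n) (C : Ideal (Rn n)) :
    ∃ p : Param, p.Canonical n ∧ C = p.code n := by
  obtain ⟨s, m, b, h⟩ := exists_hasInvariants hn.unif (isDualExtension n) C
  suffices ∃ p : Param, p.Canonical n ∧ p.resExp n = s ∧ p.torExp n = m ∧
      yA n ^ m ∣ b - p.offset n by
    obtain ⟨p, hp, rfl, rfl, hdvd⟩ := this
    exact ⟨p, hp, h.ideal_eq (isDualExtension n) (hp.hasInvariants hn) hdvd⟩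
  have h1 := hn.one_le
  have hms := h.m_le
  have hsN := h.s_le
  have hd := h.dvd
  obtain ⟨v, -, c, hc, rfl⟩ := hn.unif.exists_unit b
  rw [← mul_assoc, ← pow_add, hn.unif.pow_dvd_iff (hms.trans hsN) hc] at hd
  rcases Nat.eq_zero_or_pos s with rfl | hs
  · obtain rfl : m = 0 := by omega
    exact ⟨one, trivial, rfl, rfl, by simp⟩
  rcases hsN.lt_or_eq with hsN | rfl
  · rcases lt_or_ge s n with hsn | hsn
    · exact exists_canonical_of_lt hn hc hs hsn hms
    · exact exists_canonical_of_ge hn hc hsn hsN (by omega)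
  -- For `s = 2n` the compatibility condition reads `m ≤ v`, so `b` vanishes modulo `yᵐ`.
  · have hdvd : yA n ^ m ∣ yA n ^ v * c - 0 := by
      rw [sub_zero]; exact (pow_dvd_pow _ (by omega)).mul_right c
    rcases hms.lt_or_eq with hlt | rfl
    · exact ⟨type1 m, hlt, rfl, rfl, hdvd⟩
    · exact ⟨zero, trivial, rfl, rfl, hdvd⟩

theorem existsUnique_param (hn : IsTwoPow n) (C : Ideal (Rn n)) :
    ∃! p : Param, p.Admissible n ∧ p.Normalized ∧ C = p.code n := by
  obtain ⟨p, hp, hC⟩ := exists_canonical hn C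
  have hp' := (canonical_iff hn p).2 hp
  refine ⟨p, ⟨hp'.1, hp'.2, hC⟩, ?_⟩
  rintro q ⟨hq, hq', hC'⟩
  have hqc := (canonical_iff hn q).1 ⟨hq, hq'⟩
  have hi := hqc.hasInvariants hn
  rw [← hC', hC] at hi
  obtain ⟨hs, hm, hb⟩ := hi.unique hn.unif (isDualExtension n) (hp.hasInvariants hn)
  exact hqc.eq_of_invariants_eq hn hp hs hm hb

end Param
end Negacyclic

theorem mainTheorem1 (k : ℕ) (hk : 1 ≤ k) :
    (∀ C : Ideal (Negacyclic.Rn (2 ^ k)),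
      ∃ p : Negacyclic.Param, p.Admissible (2 ^ k) ∧ C = p.code (2 ^ k)) ∧
    (∀ C : Ideal (Negacyclic.Rn (2 ^ k)),
      ∃! p : Negacyclic.Param,
        p.Admissible (2 ^ k) ∧ p.Normalized ∧ C = p.code (2 ^ k)) := by
  have h := Negacyclic.Param.existsUnique_param ⟨k, hk, rfl⟩
  exact ⟨fun C => (h C).exists.imp fun p hp => ⟨hp.1, hp.2.2⟩, h⟩
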